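/- **Setting.** Let $n\ge 2$, let $v_1,\dots,v_p\in\mathbb Z^n$ and $\lambda_1,\dots,\lambda_p\in\mathbb R$ (for instance the primitive ray generators of the fan of a toric Fano $n$-fold and the coefficients of an ample toric divisor). For small $t>0$ put $$W_\Sigma(z)=1+\sum_{k=1}^p t^{\lambda_k}z^{v_k},\qquad Y^t=\{(z,u,v)\in(\mathbb C^*)^n\times\mathbb C^2: uv=W_\Sigma(z)\},$$ $\mathrm{Log}_t(z)=(\log|z_i|/\log t)_i$, $\chi_k(x)=\lambda_k+\langle v_k,x\rangle$, $G_{\rm trop}=\{\chi_k\ge 0\ \forall k\}$, $F_{j,\rm trop}=G_{\rm trop}\cap\{\chi_j=0\}$, and let $s_{>0}(x)=(t^{x_i})_i$. For $\sigma\subset\mathbb R^n$ and $s\in(\mathbb C^*)^n$ write $\sigma(s)=\{e^{2\pi\sqrt{-1}m}\cdot s: m\in\sigma\}$. *Neighbourhoods.* Fix $j$, and open sets $U_j''\subset\subset U_j'\subset\subset U_j$ with $U_j$ convex and $U_j''\cap F_{j,\rm trop}\neq\emptyset$, constants $0<c_j<c_k$ $(k\ne j)$ with $\chi_j<c_j$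 and $\chi_k>c_k$ on $U_j$, and a smooth $\rho:\mathbb R^n\to[0,1]$ equal to $1$ on $U_j''$ and $0$ off $U_j'$, such that for some $\varepsilon>0$, $\rho(x+sv_j)=\rho(x)$ for all $x\in U_j\cap F_{j,\rm trop}$, $|s|<\varepsilon$. Put $W_{\Sigma,j}(z)=W_\Sigma(z)-\rho(\mathrm{Log}_tz)\sum_{k\ne j}t^{\lambda_k}z^{v_k}$. *Deformation.* Let $R>R'>R''>1$ with $R''>\tfrac12(1+\sum_k|t^{\lambda_k}z^{v_k}|)$ whenever $\mathrm{Log}_t z\in U_j$, let $\tau:\mathbb C^2\to[0,1]$ be smooth, $\tau=1$ where $\frac12|u|^2,\frac12|v|^2\le R''$ and $\tau=0$ unless $\frac12|u|^2,\frac12|v|^2\le R'$. Let $Y^t_j$ be the part of $Y^t$ with $\frac12|u|^2,\frac12|v|^2\le R$, $\mathrm{Log}_tz\in U_j$, and $Y^t_{j,\rm simple}$ the set given in the same region by $uv=W_\Sigma(z)-\tau(u,v)\rho(\mathrm{Log}_tz)\sum_{k\neq j}t^{\lambda_k}z^{v_k}$. Let $\Phi_j:Y_j^t\to Y^t_{j,\rm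 simple}$ be a symplectomorphism for the restrictions of $\omega_0=\sum_i dz_i\wedge d\bar z_i/|z_i|^2+du\wedge d\bar u+dv\wedge d\bar v$ which is the identity at all points that do not satisfy both $\frac12|u|^2,\frac12|v|^2\le R'$ and $\mathrm{Log}_tz\in U'_j$. *The end.* Let $\beta_{\rm trop}$ be the intersection with $G_{\rm trop}$ of $n-1$ tropical hypersurfaces $V(f_1),\dots,V(f_{n-1})$, and $e$ an edge of it, dual to the $(n-1)$-dimensional cell $\sigma_e=\sum_k[q_k,q_k']$, where $[q_k,q'_k]$ (with integral endpoints) is a 1-cell of the subdivision of the Newton polytope of $f_k$; put $\xi_k=q_k'-q_k$. Let $e$ have an end $a\in U_j\cap F_{j,\rm trop}$ and direction $v_j$, and let $\ell>0$ be such that the segment $r_a(\tau)=a+(1-\tau)\ell v_j$, $0\le\tau\le1$, lies on $e$ and in $U_j$, and $r_a(0)\notin U_j'$. Let $s(\tau)\in\mathrm{Log}_t^{-1}(r_a(\tau))$ be a continuous path with $s(0)=s_{>0}(r_a(0))$, $1+t^{\lambda_j}s(1)^{v_j}=0$, along which the phase of $s(\tau)^{v_j}$ runs counterclockwise (weakly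 monotonically) from $1$ to $-1$ through the upper half circle. Put $$\Gamma_a=\Phi_j^{-1}\{(z,u,v)\in Y^t_{j,\rm simple}: |u|=|v|,\ z\in\sigma_e(s(\tau)),\ \tau\in[0,1]\}.$$ *The added chain.* Let $\gamma\in\mathbb Z^n$ with $\langle\gamma,v_j\rangle=1$, $\tilde\sigma=\sigma_e+[0,\gamma]$, $r=r_{\rm add}:[0,1]\to U_j\setminus U_j'$ a continuous path with $r(\frac12)=r_a(0)$, such that for all $k\neq j$, $t^{\chi_j(r(0))}+(p-1)t^{c_k}<1$ and $t^{\chi_j(r(1))}>1+(p-1)t^{c_k}$. Let $r_0^\pm:[0,1]\to(0,\infty)$ be continuous with $2\sqrt{r_0^+r_0^-}=|W_\Sigma(s_{>0}(r))|$ at $\tau=0$ and $\tau=1$. With $\tilde\sigma(\tau)=\tilde\sigma(s_{>0}(r(\tau)))$, let $\Gamma_{\rm add}$ be the union of the following seven subsets of $Y^t$, where $\mu,\kappa\in[0,1]$ and $\theta\in[0,2\pi]$: * $\Gamma^{+,1}$: $z\in\tilde\sigma(\tau)$, $u=\sqrt{2r_0^+(\tau)}$, $\tau\in[0,\frac12]$;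 * $\Gamma_{av}$: $z\in\tilde\sigma(\frac12)$, $u=e^{\sqrt{-1}\kappa\arg(z^{v_j})}\sqrt{2r_0^+(\frac12)}$, where $\arg(z^{v_j})=2\pi\eta$ at the point of $\tilde\sigma(\frac12)$ given by $m+\eta\gamma$, $m\in\sigma_e$, $\eta\in[0,1]$; * $\Gamma^{+,2}$: $z\in\tilde\sigma(\tau)$, $u=e^{\sqrt{-1}\arg(z^{v_j})}\sqrt{2r_0^+(\tau)}$, $\tau\in[\frac12,1]$; * $\Gamma^-$: $z\in\tilde\sigma(\tau)$, $v=\sqrt{2r_0^-(\tau)}$, $\tau\in[0,1]$; * $\Gamma_{\rm in}$: $z\in\tilde\sigma(0)$, $u=e^{\sqrt{-1}\arg(\mu W_\Sigma(z)+1-\mu)}\left|\frac{W_\Sigma(z)}{W_\Sigma(s_{>0}(r(0)))}\right|^{\mu}\sqrt{2r_0^+(0)}$; * $\Gamma_{\rm out}$: $z\in\tilde\sigma(1)$, $v=e^{\sqrt{-1}\arg((\mu W_\Sigma(z)+(1-\mu)t^{\lambda_j}z^{v_j})/z^{v_j})}\left|\frac{W_\Sigma(z)}{W_\Sigma(s_{>0}(r(1)))}\right|^{\mu}\sqrt{2r_0^-(1)}$;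 * $\Gamma_{\rm co}$: $z\in\sigma_e(s_{>0}(r(\frac12)))$, $u=\big(\mu|W_\Sigma(z)|^{1/2}+(1-\mu)\sqrt{2r_0^+(\frac12)}\big)e^{\sqrt{-1}\theta}$. Put $\Gamma_{a,\rm total}=\Gamma_a\cup\Gamma_{\rm add}$; the choices are made so that $\Gamma_{\rm add}\subset Y_j^t$. *Singular fibers.* For $x\in U_j\cap F_{j,\rm trop}$ write $z_x(\tau,\alpha,\eta)=\exp\big(\log t\,(x+\tau v_j)+\sqrt{-1}(\alpha\gamma+\sum_k\eta_k\xi_k)\big)$. If for every $\eta\in[0,2\pi]^{n-1}$ there are unique $\tau=\tau_x(\eta)\in\mathbb R$, $\alpha=\alpha_x(\eta)\in\mathbb R/2\pi\mathbb Z$ with $x+\tau v_j\in U_j$ and $W_{\Sigma,j}(z_x(\tau,\alpha,\eta))=0$, the singular fiber $SF_{x,e}$ is the set of all $(z,u,v)$ with $z=z_x(\tau_x(\eta),\alpha_x(\eta)+\eta_a,\eta)$, $u=|W_{\Sigma,j}(z)|^{1/2}e^{\sqrt{-1}\theta_0}$, $v=W_{\Sigma,j}(z)|W_{\Sigma,j}(z)|^{-1/2}e^{-\sqrt{-1}\theta_0}$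 (read as $0$ where $W_{\Sigma,j}(z)=0$), $\eta\in[0,2\pi]^{n-1}$, $\eta_a,\theta_0\in[0,2\pi]$. **Proposition.** Given $v,\lambda,j$, the neighbourhoods with $\rho$, the $f_k$, the end $a$ of $e$ with $\ell$, the vector $\gamma$ and the path $r_{\rm add}$, there is $t_0>0$ such that for all $0<t<t_0$ and all choices of $R,R',R'',\tau,\Phi_j,s,r_0^{\pm}$ as above there is a point $\tilde a\in (F_{j,\rm trop}\cap U_j)\setminus U_j'$ at which the singular fiber is well-defined, and a continuous map $$H:\Gamma_{a,\rm total}\times[0,1]\to Y^t_j$$ with $H(\cdot,0)$ the identity of $\Gamma_{a,\rm total}$ (so $H(\Gamma_{a,\rm total}\times\{0\})=\Gamma_{a,\rm total}$) and $H(\Gamma_{a,\rm total}\times\{1\})=SF_{\tilde a,e}$. -/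

import Mathlib

open scoped ContDiff

noncomputable section

namespace HV

/-- Points `(z, u, v)` of `ℂⁿ × ℂ²`. -/
abbrev Pt (n : ℕ) : Type := (Fin n → ℂ) × ℂ × ℂ

/-- An integer vector seen as a real vector. -/
def ivec {n : ℕ} (m : Fin n → ℤ) : Fin n → ℝ := fun i => (m i : ℝ)

/-- The pairing `⟨m, x⟩`. -/
def pair {n : ℕ} (m : Fin n → ℤ) (x : Fin n → ℝ) : ℝ := ∑ i, (m i : ℝ) * x i

/-- The Laurent monomial `z^m`. -/
def monom {n : ℕ} (m : Fin n → ℤ) (z : Fin n → ℂ) : ℂ := ∏ i, z i ^ m i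

/-- The rescaled logarithm map `Log_t`. -/
def Logt {n : ℕ} (t : ℝ) (z : Fin n → ℂ) : Fin n → ℝ :=
  fun i => Real.log ‖z i‖ / Real.log t

/-- The positive real point `s_{real>0}(x)` of `Log_t⁻¹(x)`. -/
def sreal {n : ℕ} (t : ℝ) (x : Fin n → ℝ) : Fin n → ℂ := fun i => ((t ^ x i : ℝ) : ℂ)

/-- `exp(√-1 arg c)` for `c ≠ 0`. -/
def phase (c : ℂ) : ℂ := c / (‖c‖ : ℂ)

/-- The cycle `σ(s)` in `(ℂ*)ⁿ`: the image of `σ` under `m ↦ exp(2π√-1 m) · s`. -/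
def cyc {n : ℕ} (σ : Set (Fin n → ℝ)) (s : Fin n → ℂ) : Set (Fin n → ℂ) :=
  {z | ∃ m ∈ σ, z = fun i => Complex.exp (2 * Real.pi * Complex.I * (m i : ℂ)) * s i}

/-! ### The potential and the tropical polytope -/

/-- Exponents `v_k` and weights `λ_k` of the potential `1 + ∑ t^{λ_k} z^{v_k}`. -/
structure Potential (n p : ℕ) where
  v : Fin p → Fin n → ℤ
  lam : Fin p → ℝ

/-- The term `t^{λ_k} z^{v_k}`. -/
def Potential.term {n p : ℕ} (P : Potential n p) (t : ℝ) (k : Fin p) (z : Fin n → ℂ) : ℂ :=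
  ((t ^ P.lam k : ℝ) : ℂ) * monom (P.v k) z

/-- `W_Σ(z)`. -/
def Potential.W {n p : ℕ} (P : Potential n p) (t : ℝ) (z : Fin n → ℂ) : ℂ :=
  1 + ∑ k, P.term t k z

/-- `χ_k(x) = λ_k + ⟨v_k, x⟩`. -/
def Potential.chi {n p : ℕ} (P : Potential n p) (k : Fin p) (x : Fin n → ℝ) : ℝ :=
  P.lam k + pair (P.v k) x

/-- The polytope `G_trop`. -/
def Potential.G {n p : ℕ} (P : Potential n p) : Set (Fin n → ℝ) := {x | ∀ k, 0 ≤ P.chi k x}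

/-- The facet `F_{j,trop}`. -/
def Potential.facet {n p : ℕ} (P : Potential n p) (j : Fin p) : Set (Fin n → ℝ) :=
  {x | x ∈ P.G ∧ P.chi j x = 0}

/-- The mirror `Y^t = {uv = W_Σ(z)}` in `(ℂ*)ⁿ × ℂ²`. -/
def Potential.Yt {n p : ℕ} (P : Potential n p) (t : ℝ) : Set (Pt n) :=
  {q | (∀ i, q.1 i ≠ 0) ∧ q.2.1 * q.2.2 = P.W t q.1}

/-- The condition `μ₀(q) ∈ [0,R]² × (log t · U)`. -/
def inBox {n : ℕ} (t R : ℝ) (U : Set (Fin n → ℝ)) (q : Pt n) : Prop :=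
  ‖q.2.1‖ ^ 2 / 2 ≤ R ∧ ‖q.2.2‖ ^ 2 / 2 ≤ R ∧ Logt t q.1 ∈ U

/-! ### The deformation near a facet -/

/-- The open sets `U_j'' ⊂⊂ U_j' ⊂⊂ U_j` around a part of the facet `F_{j,trop}`, with the constants
`c_k`, and the cut-off function `ρ_j` (so that `ρ_{j,t} = ρ_j ∘ Log_t`), which does not vary in the
direction `v_j` close to the facet. -/
structure FacetNbhd {n p : ℕ} (P : Potential n p) (j : Fin p) where
  U : Set (Fin n → ℝ)
  U' : Set (Fin n → ℝ)
  U'' : Set (Fin n → ℝ)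
  c : Fin p → ℝ
  rho : (Fin n → ℝ) → ℝ
  isOpen_U : IsOpen U
  isOpen_U' : IsOpen U'
  isOpen_U'' : IsOpen U''
  convex_U : Convex ℝ U
  compact_U' : IsCompact (closure U')
  closure_U' : closure U' ⊆ U
  compact_U'' : IsCompact (closure U'')
  closure_U'' : closure U'' ⊆ U'
  meets_facet : (U'' ∩ P.facet j).Nonempty
  c_pos : 0 < c j
  c_lt : ∀ k, k ≠ j → c j < c k
  chi_lt : ∀ x ∈ U, P.chi j x < c j
  lt_chi : ∀ x ∈ U, ∀ k, k ≠ j → c k < P.chi k x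
  rho_smooth : ContDiff ℝ ∞ rho
  rho_mem : ∀ x, rho x ∈ Set.Icc (0 : ℝ) 1
  rho_one : ∀ x ∈ U'', rho x = 1
  rho_zero : ∀ x, x ∉ U' → rho x = 0
  rho_const : ∃ ε > 0, ∀ x ∈ U ∩ P.facet j, ∀ s : ℝ, |s| < ε →
    rho (x + s • ivec (P.v j)) = rho x

/-- `W_{Σ,j}(z) = W_Σ(z) - ρ_{j,t}(z) ∑_{k ≠ j} t^{λ_k} z^{v_k}` -/
def FacetNbhd.Wj {n p : ℕ} {P : Potential n p} {j : Fin p} (N : FacetNbhd P j) (t : ℝ)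
    (z : Fin n → ℂ) : ℂ :=
  P.W t z - (N.rho (Logt t z) : ℂ) * ∑ k ∈ Finset.univ.erase j, P.term t k z

/-- `Y^t_j = Y^t ∩ μ₀⁻¹([0,R]² × (log t · U_j))` -/
def FacetNbhd.Yj {n p : ℕ} {P : Potential n p} {j : Fin p} (N : FacetNbhd P j) (t R : ℝ) :
    Set (Pt n) :=
  {q | q ∈ P.Yt t ∧ inBox t R N.U q}

/-- `Y^t_{j,simple}`, given by
`uv = W_Σ(z) - τ(u,v) ρ_{j,t}(z) ∑_{k ≠ j} t^{λ_k} z^{v_k}` in the same region. -/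
def FacetNbhd.Ysimple {n p : ℕ} {P : Potential n p} {j : Fin p} (N : FacetNbhd P j) (t R : ℝ)
    (tau : ℂ × ℂ → ℝ) : Set (Pt n) :=
  {q | (∀ i, q.1 i ≠ 0) ∧
    q.2.1 * q.2.2 = P.W t q.1 - (tau q.2 : ℂ) * (N.rho (Logt t q.1) : ℂ) *
      ∑ k ∈ Finset.univ.erase j, P.term t k q.1 ∧
    inBox t R N.U q}

/-- The form `ω₀ = ∑ dz_i ∧ dz̄_i / |z_i|² + du ∧ dū + dv ∧ dv̄` at `q`. -/
def omega0 {n : ℕ} (q ξ ζ : Pt n) : ℂ :=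
  (∑ i, (ξ.1 i * star (ζ.1 i) - ζ.1 i * star (ξ.1 i)) / ((‖q.1 i‖ ^ 2 : ℝ) : ℂ)) +
    (ξ.2.1 * star ζ.2.1 - ζ.2.1 * star ξ.2.1) + (ξ.2.2 * star ζ.2.2 - ζ.2.2 * star ξ.2.2)

/-- `Φ` restricts to a diffeomorphism `A → B` of submanifolds (with corners) of `ℂⁿ × ℂ²` which
matches the restrictions of `ω₀` to `A` and `B`. -/
structure IsSymplectomorphism {n : ℕ} (A B : Set (Pt n)) (Φ : Pt n → Pt n) : Prop where
  bijOn : Set.BijOn Φ A B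
  smooth : ContDiffOn ℝ ∞ Φ A
  smooth_inv : ∃ Ψ : Pt n → Pt n, ContDiffOn ℝ ∞ Ψ B ∧ Set.InvOn Ψ Φ A B
  preserves : ∀ q ∈ A, ∃ L : Pt n →L[ℝ] Pt n, HasFDerivWithinAt Φ L A q ∧
    ∀ ξ ∈ tangentConeAt ℝ A q, ∀ ζ ∈ tangentConeAt ℝ A q,
      omega0 (Φ q) (L ξ) (L ζ) = omega0 q ξ ζ

/-- Radii `R > R' > R''`, the cut-off function `τ(u,v)` and the symplectomorphism
`Φ_j : Y^t_j → Y^t_{j,simple}`. -/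
structure Deformation {n p : ℕ} {P : Potential n p} {j : Fin p} (N : FacetNbhd P j)
    (t : ℝ) where
  R : ℝ
  R' : ℝ
  R'' : ℝ
  R'_lt : R' < R
  R''_lt : R'' < R'
  one_lt : 1 < R''
  bound : ∀ z : Fin n → ℂ, (∀ i, z i ≠ 0) → Logt t z ∈ N.U →
    (1 + ∑ k, ‖P.term t k z‖) / 2 < R''
  tau : ℂ × ℂ → ℝ
  tau_smooth : ContDiff ℝ ∞ tau
  tau_mem : ∀ w, tau w ∈ Set.Icc (0 : ℝ) 1
  tau_one : ∀ w : ℂ × ℂ, ‖w.1‖ ^ 2 / 2 ≤ R'' → ‖w.2‖ ^ 2 / 2 ≤ R'' → tau w = 1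
  tau_zero : ∀ w : ℂ × ℂ, ¬ (‖w.1‖ ^ 2 / 2 ≤ R' ∧ ‖w.2‖ ^ 2 / 2 ≤ R') → tau w = 0
  Phi : Pt n → Pt n
  symplecto : IsSymplectomorphism (N.Yj t R) (N.Ysimple t R tau) Phi
  eq_id : ∀ q ∈ N.Yj t R, ¬ inBox t R' N.U' q → Phi q = q

/-! ### The tropical curve and its ends -/

/-- A tropical (max-plus) Laurent polynomial `⊕_m coeff(m) ⊙ ⟨m, x⟩`. -/
structure TropPoly (n : ℕ) where
  supp : Finset (Fin n → ℤ)
  nonempty : supp.Nonempty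
  coeff : (Fin n → ℤ) → ℝ

def TropPoly.eval {n : ℕ} (f : TropPoly n) (x : Fin n → ℝ) : ℝ :=
  f.supp.sup' f.nonempty fun m => f.coeff m + pair m x

/-- The monomials attaining the maximum at `x`. -/
def TropPoly.leading {n : ℕ} (f : TropPoly n) (x : Fin n → ℝ) : Set (Fin n → ℤ) :=
  {m | m ∈ f.supp ∧ f.coeff m + pair m x = f.eval x}

/-- The cell, dual to `x`, of the subdivision of the Newton polytope. -/
def TropPoly.cell {n : ℕ} (f : TropPoly n) (x : Fin n → ℝ) : Set (Fin n → ℝ) :=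
  convexHull ℝ (ivec '' f.leading x)

/-- The tropical hypersurface `V(f)`: the maximum is attained at least twice. -/
def TropPoly.hypersurface {n : ℕ} (f : TropPoly n) : Set (Fin n → ℝ) :=
  {x | (f.leading x).Nontrivial}

/-- The tropical curve `β_{trop,C}`: the intersection of the `n - 1` tropical hypersurfaces
`V(f_k)`, cut off at the boundary of `G_trop`. -/
def tropCurve {n p : ℕ} (P : Potential n p) (f : Fin (n - 1) → TropPoly n) :
    Set (Fin n → ℝ) :=
  {x | x ∈ P.G ∧ ∀ k, x ∈ (f k).hypersurface}

/-- An end `a ∈ U_j ∩ F_{j,trop}` of an edge `e` of the tropical curve. The edge is dual to the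
`(n-1)`-dimensional cell `σ_e = ∑_k [q_k, q'_k]`, the `k`-th segment being a 1-cell of the
subdivision defined by `f_k`. The segment `β_a` from `a + ℓ v_j ∈ U_j ∖ U_j'` to `a` lies on `e`
and in `U_j`. -/
structure EdgeEnd {n p : ℕ} {P : Potential n p} {j : Fin p} (N : FacetNbhd P j)
    (f : Fin (n - 1) → TropPoly n) where
  a : Fin n → ℝ
  a_mem : a ∈ N.U ∩ P.facet j
  q : Fin (n - 1) → Fin n → ℤ
  q' : Fin (n - 1) → Fin n → ℤ
  indep : LinearIndependent ℝ fun k => ivec (q' k - q k)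
  len : ℝ
  len_pos : 0 < len
  edge : ∀ s ∈ Set.Icc 0 len, a + s • ivec (P.v j) ∈ tropCurve P f ∧
    ∀ k, (f k).cell (a + s • ivec (P.v j)) = segment ℝ (ivec (q k)) (ivec (q' k))
  mem_U : ∀ s ∈ Set.Icc 0 len, a + s • ivec (P.v j) ∈ N.U
  start_notMem : a + len • ivec (P.v j) ∉ N.U'

namespace EdgeEnd

variable {n p : ℕ} {P : Potential n p} {j : Fin p} {N : FacetNbhd P j}
  {f : Fin (n - 1) → TropPoly n}

/-- The integral vectors `ξ_a^{⊥,k}`. -/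
def xi (e : EdgeEnd N f) (k : Fin (n - 1)) : Fin n → ℤ := e.q' k - e.q k

/-- The cell `σ_e`, a Minkowski sum of segments. -/
def sigma (e : EdgeEnd N f) : Set (Fin n → ℝ) :=
  {x | ∃ h : Fin (n - 1) → ℝ, (∀ k, h k ∈ Set.Icc (0 : ℝ) 1) ∧
    x = ∑ k, (ivec (e.q k) + h k • ivec (e.xi k))}

/-- The path `r_a` along `β_a`, with `r_a(1) = a`. -/
def ra (e : EdgeEnd N f) (τ : ℝ) : Fin n → ℝ := e.a + ((1 - τ) * e.len) • ivec (P.v j)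

/-- The cell `σ̃_a = σ_e + [0, γ_a]`. -/
def sigmaTilde (e : EdgeEnd N f) (γ : Fin n → ℤ) : Set (Fin n → ℝ) :=
  {x | ∃ m ∈ e.sigma, ∃ h ∈ Set.Icc (0 : ℝ) 1, x = m + h • ivec γ}

/-- The requirements on the path `r_add` that do not involve `t`. -/
structure IsAddPath (e : EdgeEnd N f) (r : ℝ → Fin n → ℝ) : Prop where
  cont : ContinuousOn r (Set.Icc 0 1)
  mem_U : ∀ τ ∈ Set.Icc (0 : ℝ) 1, r τ ∈ N.U
  notMem_U' : ∀ τ ∈ Set.Icc (0 : ℝ) 1, r τ ∉ N.U'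
  half : r (1 / 2) = e.ra 0

/-- The path `s(r_a(τ)) ∈ Log_t⁻¹(r_a(τ))`: it starts at the positive real point, ends at a zero of
`1 + t^{λ_j} z^{v_j}`, and the phase of `s^{v_j}` runs counterclockwise from `1` to `-1`. -/
structure IsLift (e : EdgeEnd N f) (t : ℝ) (s : ℝ → Fin n → ℂ) : Prop where
  cont : ContinuousOn s (Set.Icc 0 1)
  ne_zero : ∀ τ ∈ Set.Icc (0 : ℝ) 1, ∀ i, s τ i ≠ 0
  log_eq : ∀ τ ∈ Set.Icc (0 : ℝ) 1, Logt t (s τ) = e.ra τ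
  start : s 0 = sreal t (e.ra 0)
  finish : 1 + P.term t j (s 1) = 0
  angle : ∃ φ : ℝ → ℝ, ContinuousOn φ (Set.Icc 0 1) ∧ MonotoneOn φ (Set.Icc 0 1) ∧
    φ 0 = 0 ∧ φ 1 = Real.pi ∧ ∀ τ ∈ Set.Icc (0 : ℝ) 1,
      phase (monom (P.v j) (s τ)) = Complex.exp (Complex.I * (φ τ : ℂ))

/-- The chain `Γ_a = Φ_j^*{z ∈ σ_a(s(r_a(τ))), |u| = |v|}`. -/
def GammaA (e : EdgeEnd N f) {t : ℝ} (D : Deformation N t) (s : ℝ → Fin n → ℂ) : Set (Pt n) :=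
  {x | x ∈ N.Yj t D.R ∧ ∃ y ∈ N.Ysimple t D.R D.tau, D.Phi x = y ∧ ‖y.2.1‖ = ‖y.2.2‖ ∧
    ∃ τ ∈ Set.Icc (0 : ℝ) 1, y.1 ∈ cyc e.sigma (s τ)}

/-- The data from which `Γ_add` is built: the vector `γ_a`, the path `r_add` and the radii `r_0^±`. -/
structure AddData (n : ℕ) where
  γ : Fin n → ℤ
  r : ℝ → Fin n → ℝ
  rp : ℝ → ℝ
  rm : ℝ → ℝ

/-- The requirements on the data of `Γ_add` at the parameter `t`. -/
structure IsAdmissible (N : FacetNbhd P j) (t : ℝ) (A : AddData n) : Prop where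
  inner : ∀ k, k ≠ j → t ^ P.chi j (A.r 0) + ((p : ℝ) - 1) * t ^ N.c k < 1
  outer : ∀ k, k ≠ j → 1 + ((p : ℝ) - 1) * t ^ N.c k < t ^ P.chi j (A.r 1)
  rp_cont : ContinuousOn A.rp (Set.Icc 0 1)
  rm_cont : ContinuousOn A.rm (Set.Icc 0 1)
  rp_pos : ∀ τ ∈ Set.Icc (0 : ℝ) 1, 0 < A.rp τ
  rm_pos : ∀ τ ∈ Set.Icc (0 : ℝ) 1, 0 < A.rm τ
  at_zero : 2 * √(A.rp 0 * A.rm 0) = ‖P.W t (sreal t (A.r 0))‖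
  at_one : 2 * √(A.rp 1 * A.rm 1) = ‖P.W t (sreal t (A.r 1))‖

/-- `σ̃_a(τ)` -/
def tildeAt (e : EdgeEnd N f) (t : ℝ) (A : AddData n) (τ : ℝ) : Set (Fin n → ℂ) :=
  cyc (e.sigmaTilde A.γ) (sreal t (A.r τ))

/-- `Γ^{+,part1}` -/
def GammaPlus1 (e : EdgeEnd N f) (t : ℝ) (A : AddData n) : Set (Pt n) :=
  {x | x ∈ P.Yt t ∧ ∃ τ ∈ Set.Icc (0 : ℝ) (1 / 2),
    x.1 ∈ e.tildeAt t A τ ∧ x.2.1 = (√(2 * A.rp τ) : ℂ)}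

/-- `Γ_av`. On `σ̃_a = σ_e + η_a γ_a`, `η_a ∈ [0,1]`, the angle `arg(z^{v_j}) ∈ [0,2π]` is
`2π η_a`. -/
def GammaAv (e : EdgeEnd N f) (t : ℝ) (A : AddData n) : Set (Pt n) :=
  {x | x ∈ P.Yt t ∧ ∃ m ∈ e.sigma, ∃ h ∈ Set.Icc (0 : ℝ) 1, ∃ s ∈ Set.Icc (0 : ℝ) 1,
    x.1 ∈ cyc {m + h • ivec A.γ} (sreal t (A.r (1 / 2))) ∧
    x.2.1 = Complex.exp (Complex.I * (s * (2 * Real.pi * h) : ℝ)) * (√(2 * A.rp (1 / 2)) : ℂ)}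

/-- `Γ^{+,part2}` -/
def GammaPlus2 (e : EdgeEnd N f) (t : ℝ) (A : AddData n) : Set (Pt n) :=
  {x | x ∈ P.Yt t ∧ ∃ τ ∈ Set.Icc (1 / 2 : ℝ) 1, x.1 ∈ e.tildeAt t A τ ∧
    x.2.1 = phase (monom (P.v j) x.1) * (√(2 * A.rp τ) : ℂ)}

/-- `Γ^-` -/
def GammaMinus (e : EdgeEnd N f) (t : ℝ) (A : AddData n) : Set (Pt n) :=
  {x | x ∈ P.Yt t ∧ ∃ τ ∈ Set.Icc (0 : ℝ) 1,
    x.1 ∈ e.tildeAt t A τ ∧ x.2.2 = (√(2 * A.rm τ) : ℂ)}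

/-- `Γ_out` -/
def GammaOut (e : EdgeEnd N f) (t : ℝ) (A : AddData n) : Set (Pt n) :=
  {x | x ∈ P.Yt t ∧ x.1 ∈ e.tildeAt t A 1 ∧ ∃ μ ∈ Set.Icc (0 : ℝ) 1,
    x.2.2 = phase (((μ : ℂ) * P.W t x.1 + (1 - μ : ℂ) * P.term t j x.1) / monom (P.v j) x.1) *
      (((‖P.W t x.1‖ / ‖P.W t (sreal t (A.r 1))‖) ^ μ * √(2 * A.rm 1) : ℝ) : ℂ)}

/-- `Γ_in` -/
def GammaIn (e : EdgeEnd N f) (t : ℝ) (A : AddData n) : Set (Pt n) :=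
  {x | x ∈ P.Yt t ∧ x.1 ∈ e.tildeAt t A 0 ∧ ∃ μ ∈ Set.Icc (0 : ℝ) 1,
    x.2.1 = phase ((μ : ℂ) * P.W t x.1 + (1 - μ : ℂ)) *
      (((‖P.W t x.1‖ / ‖P.W t (sreal t (A.r 0))‖) ^ μ * √(2 * A.rp 0) : ℝ) : ℂ)}

/-- `Γ_co` -/
def GammaCo (e : EdgeEnd N f) (t : ℝ) (A : AddData n) : Set (Pt n) :=
  {x | x ∈ P.Yt t ∧ x.1 ∈ cyc e.sigma (sreal t (A.r (1 / 2))) ∧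
    ∃ μ ∈ Set.Icc (0 : ℝ) 1, ∃ θ ∈ Set.Icc (0 : ℝ) (2 * Real.pi),
    x.2.1 = ((μ * √‖P.W t x.1‖ + (1 - μ) * √(2 * A.rp (1 / 2)) : ℝ) : ℂ) *
      Complex.exp (Complex.I * (θ : ℂ))}

/-- `Γ_add`, the union of the seven pieces. -/
def GammaAdd (e : EdgeEnd N f) (t : ℝ) (A : AddData n) : Set (Pt n) :=
  e.GammaPlus1 t A ∪ e.GammaAv t A ∪ e.GammaPlus2 t A ∪ e.GammaMinus t A ∪ e.GammaIn t A ∪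
    e.GammaOut t A ∪ e.GammaCo t A

/-- `Γ_{a,total} = Γ_a ∪ Γ_add` -/
def GammaTotal (e : EdgeEnd N f) {t : ℝ} (D : Deformation N t) (s : ℝ → Fin n → ℂ)
    (A : AddData n) : Set (Pt n) :=
  e.GammaA D s ∪ e.GammaAdd t A

/-- `exp(log t (x + τ v_j) + √-1 (α γ_a + ∑_k η_k ξ_a^{⊥,k}))` -/
def zpt (e : EdgeEnd N f) (t : ℝ) (γ : Fin n → ℤ) (x : Fin n → ℝ) (τ α : ℝ)
    (η : Fin (n - 1) → ℝ) : Fin n → ℂ :=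
  fun i => Complex.exp ((Real.log t * (x i + τ * P.v j i) : ℝ) +
    Complex.I * (α * γ i + ∑ k, η k * e.xi k i : ℝ))

/-- `(τ, α)` is a solution of `W_{Σ,j} = 0` over the point `x` and the angles `η`, with
`x + τ v_j ∈ U_j`. -/
def IsSol (e : EdgeEnd N f) (t : ℝ) (γ : Fin n → ℤ) (x : Fin n → ℝ) (η : Fin (n - 1) → ℝ)
    (τ α : ℝ) : Prop :=
  x + τ • ivec (P.v j) ∈ N.U ∧ N.Wj t (e.zpt t γ x τ α η) = 0

/-- The solution `(τ_x(η), α_x(η)) ∈ ℝ × ℝ/2πℤ` exists and is unique for all `η`, so that the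
singular fiber at `x` makes sense. -/
def HasSingularFiber (e : EdgeEnd N f) (t : ℝ) (γ : Fin n → ℤ) (x : Fin n → ℝ) : Prop :=
  ∀ η : Fin (n - 1) → ℝ, (∀ k, η k ∈ Set.Icc 0 (2 * Real.pi)) →
    ∃! w : ℝ × ℝ, w.2 ∈ Set.Ico 0 (2 * Real.pi) ∧ e.IsSol t γ x η w.1 w.2

/-- The singular fiber `SF_{x,e}`. -/
def SF (e : EdgeEnd N f) (t : ℝ) (γ : Fin n → ℤ) (x : Fin n → ℝ) : Set (Pt n) :=
  {y | ∃ η : Fin (n - 1) → ℝ, (∀ k, η k ∈ Set.Icc 0 (2 * Real.pi)) ∧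
    ∃ ηa ∈ Set.Icc 0 (2 * Real.pi), ∃ θ ∈ Set.Icc 0 (2 * Real.pi),
    ∃ τ α : ℝ, α ∈ Set.Ico 0 (2 * Real.pi) ∧ e.IsSol t γ x η τ α ∧
      y.1 = e.zpt t γ x τ (α + ηa) η ∧
      y.2.1 = (√‖N.Wj t y.1‖ : ℂ) * Complex.exp (Complex.I * (θ : ℂ)) ∧
      y.2.2 = N.Wj t y.1 * ((√‖N.Wj t y.1‖)⁻¹ : ℂ) * Complex.exp (-(Complex.I * (θ : ℂ)))}

end EdgeEnd

end HV

end

noncomputable section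

namespace HV

/-! ### Phases, and stretching of angles -/

/-! The homotopy balances the fibre coordinates and then moves the base. Balancing changes only
`|u|` and `|v|`: it keeps `z`, the phases and `uv`, and makes `|u| = |v|`. A balanced point is
determined by `z` and the phase of `u`, and this phase is immaterial exactly where `W = 0`. Any
motion of `z` that sends zeros of `W` to zeros of `W` therefore lifts continuously to balanced
points (`continuousOn_carry`).

To build such a motion, write `W = 1 + T + rest` over `U`, where `T` is the `j`-th term and `rest`
tends to `0` with `t`. The directions `v_j` (radial) and `γ` (angular) give an action of `ℂ` that
multiplies `T` by `e^w`. Along the orbit of a point `y` with `T(y) = -1`, the equation `W = 0` reads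
`e^w = 1 + rest(w · y)`. For small `t` this is a contraction problem for the logarithm, so it has
one small solution `root y`, continuous in `y` (`exists_root`). Each `z` thus has a flat point `y`
and a radial and an angular coordinate measured from the zero of `W` on its orbit. `baseMove` slides
`y` over a base point `a`, contracts the radial coordinate to zero, and stretches the angular one by
a circle map fixing `1`; the zero locus is preserved.

The point `a` is taken on the facet in `U` but outside `U'`. There the cut-off vanishes, so `W_{Σ,j}
= W` near the relevant zeros and the singular fiber is given by `root` (`isSol_iff`). Hence the
motion ends in the singular fiber (`carry_one_mem_SF`). For surjectivity `Γ_av` alone is enough: its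
angles fill only part of the tori, but the stretching `twist` spreads that part over everything
(`exists_mem_GammaAv`). The symplectomorphism enters only through being the identity off `U'`, which
confines `Γ_a` to a compact part of `U` (`Logt_mem_shadow`). -/

lemma norm_phase {c : ℂ} (hc : c ≠ 0) : ‖phase c‖ = 1 := by
  have : ‖c‖ ≠ 0 := norm_ne_zero_iff.2 hc
  simp [phase, this]

lemma phase_ne_zero {c : ℂ} (hc : c ≠ 0) : phase c ≠ 0 := by
  rw [← norm_ne_zero_iff, norm_phase hc]; exact one_ne_zero

@[simp] lemma phase_zero : phase 0 = 0 := by simp [phase]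

lemma norm_phase_le (c : ℂ) : ‖phase c‖ ≤ 1 := by
  rcases eq_or_ne c 0 with rfl | hc
  · simp
  · exact (norm_phase hc).le

lemma norm_mul_phase (c : ℂ) : (‖c‖ : ℂ) * phase c = c := by
  rcases eq_or_ne c 0 with rfl | hc
  · simp
  · have : (‖c‖ : ℂ) ≠ 0 := by exact_mod_cast norm_ne_zero_iff.2 hc
    rw [phase]; field_simp

lemma phase_mul (a b : ℂ) : phase (a * b) = phase a * phase b := by
  simp [phase, mul_div_mul_comm]

lemma phase_of_pos {r : ℝ} (hr : 0 < r) : phase (r : ℂ) = 1 := by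
  have : (r : ℂ) ≠ 0 := by exact_mod_cast hr.ne'
  simp [phase, abs_of_pos hr, this]

lemma phase_of_norm_one {c : ℂ} (hc : ‖c‖ = 1) : phase c = c := by simp [phase, hc]

lemma continuousAt_phase {c : ℂ} (hc : c ≠ 0) : ContinuousAt phase c := by
  have : (‖c‖ : ℂ) ≠ 0 := by exact_mod_cast norm_ne_zero_iff.2 hc
  unfold phase
  fun_prop (disch := assumption)

/-- The degree one map of the circle which multiplies the angles in `[0, π]` by `1 + s` and those in
`[-π, 0]` by `1 - s`. -/
def twist (s : ℝ) (c : ℂ) : ℂ := c * Complex.exp (Complex.I * (s * Real.arccos c.re : ℝ))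

/-- On the unit circle `arccos` of the real part is the absolute value of the argument, so no branch
cut appears; the factors `1 + s` and `1 - s` agree at `-1` because their angles there differ by
`2π`. -/
lemma continuous_twist : Continuous fun w : ℝ × ℂ => twist w.1 w.2 := by
  unfold twist
  have := Real.continuous_arccos
  fun_prop

lemma norm_exp_I_mul (x : ℝ) : ‖Complex.exp (Complex.I * (x : ℂ))‖ = 1 := by
  rw [mul_comm]; exact Complex.norm_exp_ofReal_mul_I x

@[simp] lemma norm_twist (s : ℝ) (c : ℂ) : ‖twist s c‖ = ‖c‖ := by
  rw [twist, norm_mul, norm_exp_I_mul, mul_one]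

@[simp] lemma twist_zero_left (c : ℂ) : twist 0 c = c := by simp [twist]

@[simp] lemma twist_one (s : ℝ) : twist s 1 = 1 := by simp [twist]

lemma twist_exp (s : ℝ) {φ : ℝ} (h0 : 0 ≤ φ) (h1 : φ ≤ Real.pi) :
    twist s (Complex.exp (Complex.I * (φ : ℂ))) =
      Complex.exp (Complex.I * (((1 + s) * φ : ℝ) : ℂ)) := by
  have : (Complex.exp (Complex.I * (φ : ℂ))).re = Real.cos φ := by
    rw [mul_comm, Complex.exp_ofReal_mul_I_re]
  rw [twist, this, Real.arccos_cos h0 h1, ← Complex.exp_add]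
  congr 1; push_cast; ring

/-- A complex number of modulus one has an angle in any half-open interval of length `2π`. -/
lemma exists_angle {c : ℂ} (hc : ‖c‖ = 1) (b : ℝ) :
    ∃ φ ∈ Set.Ico b (b + 2 * Real.pi), Complex.exp (Complex.I * (φ : ℂ)) = c := by
  refine ⟨toIcoMod Real.two_pi_pos b c.arg, toIcoMod_mem_Ico _ _ _, ?_⟩
  have h := Complex.norm_mul_exp_arg_mul_I c
  rw [hc] at h
  rw [toIcoMod]
  have : Complex.exp (-((toIcoDiv Real.two_pi_pos b c.arg : ℤ) * (2 * Real.pi * Complex.I))) = 1 := by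
    rw [← neg_mul, ← Int.cast_neg, Complex.exp_int_mul_two_pi_mul_I]
  calc _ = Complex.exp (c.arg * Complex.I) *
        Complex.exp (-((toIcoDiv Real.two_pi_pos b c.arg : ℤ) * (2 * Real.pi * Complex.I))) := by
        rw [← Complex.exp_add]; congr 1; push_cast [zsmul_eq_mul]; ring
    _ = c := by rw [this, mul_one]; simpa using h

/-- A product with a bounded factor is continuous where the other factor is continuous and
vanishes. -/
lemma continuousWithinAt_mul_of_zero {X : Type*} [TopologicalSpace X] {S : Set X} {f g : X → ℂ}
    {x : X} (hf : ContinuousWithinAt f S x) (h0 : f x = 0) (hg : ∀ y, ‖g y‖ ≤ 1) :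
    ContinuousWithinAt (fun y => f y * g y) S x := by
  have h : Filter.Tendsto f (nhdsWithin x S) (nhds 0) := by rw [← h0]; exact hf
  have : Filter.Tendsto (fun y => f y * g y) (nhdsWithin x S) (nhds 0) := by
    refine squeeze_zero_norm (fun y => ?_) (by simpa using h.norm)
    rw [norm_mul]
    exact mul_le_of_le_one_right (norm_nonneg _) (hg y)
  simpa [ContinuousWithinAt, h0] using this

/-- The half-way factor `c / √|c|`. -/
def halfv (c : ℂ) : ℂ := c * ((√‖c‖ : ℂ)⁻¹)

lemma norm_halfv (c : ℂ) : ‖halfv c‖ = √‖c‖ := by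
  rcases eq_or_ne c 0 with rfl | hc
  · simp [halfv]
  · have h : 0 < ‖c‖ := norm_pos_iff.2 hc
    have h2 : 0 < √‖c‖ := Real.sqrt_pos.2 h
    rw [halfv, norm_mul, norm_inv, Complex.norm_real, Real.norm_of_nonneg h2.le]
    field_simp
    exact (Real.sq_sqrt h.le).symm

lemma sqrt_mul_halfv (c : ℂ) : (√‖c‖ : ℂ) * halfv c = c := by
  rcases eq_or_ne c 0 with rfl | hc
  · simp [halfv]
  · have h2 : (√‖c‖ : ℂ) ≠ 0 := by
      exact_mod_cast (Real.sqrt_pos.2 (norm_pos_iff.2 hc)).ne'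
    rw [halfv]; field_simp

lemma halfv_eq (c : ℂ) : halfv c = √‖c‖ * phase c := by
  rcases eq_or_ne c 0 with rfl | hc
  · simp [halfv]
  · have h2 : (√‖c‖ : ℂ) ≠ 0 := by
      exact_mod_cast (Real.sqrt_pos.2 (norm_pos_iff.2 hc)).ne'
    have h3 : (‖c‖ : ℂ) = √‖c‖ * √‖c‖ := by
      exact_mod_cast (Real.mul_self_sqrt (norm_nonneg c)).symm
    rw [halfv, phase, h3]; field_simp

lemma continuous_halfv : Continuous halfv := by
  rw [continuous_iff_continuousAt]
  intro c
  rcases eq_or_ne c 0 with rfl | hc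
  · have h0 : halfv 0 = 0 := by simp [halfv]
    rw [ContinuousAt, h0]
    refine squeeze_zero_norm (fun y => (norm_halfv y).le) ?_
    have : Continuous fun y : ℂ => √‖y‖ := by fun_prop
    simpa using this.tendsto 0
  · have h2 : (√‖c‖ : ℂ) ≠ 0 := by
      exact_mod_cast (Real.sqrt_pos.2 (norm_pos_iff.2 hc)).ne'
    unfold halfv
    fun_prop (disch := assumption)

/-! ### Balancing the fibre coordinates -/

/-- `|u_s|²`, where `|u_s| |v_s| = |u| |v|` and `|u_s|² - |v_s|² = (1 - s) (|u|² - |v|²)`. -/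
def balSq (s a b : ℝ) : ℝ :=
  √(((1 - s) * (a ^ 2 - b ^ 2) / 2) ^ 2 + (a * b) ^ 2) + (1 - s) * (a ^ 2 - b ^ 2) / 2

lemma continuous_balSq : Continuous fun w : ℝ × ℝ × ℝ => balSq w.1 w.2.1 w.2.2 := by
  unfold balSq; fun_prop

lemma balSq_nonneg (s a b : ℝ) : 0 ≤ balSq s a b := by
  have := Real.abs_le_sqrt (x := (1 - s) * (a ^ 2 - b ^ 2) / 2)
    (y := ((1 - s) * (a ^ 2 - b ^ 2) / 2) ^ 2 + (a * b) ^ 2) (by nlinarith [sq_nonneg (a * b)])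
  have := neg_abs_le ((1 - s) * (a ^ 2 - b ^ 2) / 2)
  unfold balSq; linarith

lemma balSq_zero {a b : ℝ} : balSq 0 a b = a ^ 2 := by
  have : ((1 - 0) * (a ^ 2 - b ^ 2) / 2) ^ 2 + (a * b) ^ 2 = ((a ^ 2 + b ^ 2) / 2) ^ 2 := by ring
  rw [balSq, this, Real.sqrt_sq (by positivity)]; ring

lemma balSq_one {a b : ℝ} (ha : 0 ≤ a) (hb : 0 ≤ b) : balSq 1 a b = a * b := by
  simp [balSq, Real.sqrt_sq (mul_nonneg ha hb)]

/-- With `d` half the damped difference, the two factors are the conjugates `√(d² + (ab)²) ± d`. -/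
lemma balSq_mul (s a b : ℝ) : balSq s a b * balSq s b a = (a * b) ^ 2 := by
  have h1 : ((1 - s) * (b ^ 2 - a ^ 2) / 2) ^ 2 + (b * a) ^ 2 =
    ((1 - s) * (a ^ 2 - b ^ 2) / 2) ^ 2 + (a * b) ^ 2 := by ring
  have h2 := Real.mul_self_sqrt (show 0 ≤ ((1 - s) * (a ^ 2 - b ^ 2) / 2) ^ 2 + (a * b) ^ 2 by
    positivity)
  unfold balSq
  rw [h1]
  linear_combination h2

/-- Keeps the balancing inside the box of radius `R`. After isolating the root and squaring, the
claim is `a²b² ≤ m² - 2md`; when `a² ≥ b²` it follows from `(m - a²)(m + b²) ≥ 0`. -/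
lemma balSq_le {s a b m : ℝ} (hs : s ∈ Set.Icc (0 : ℝ) 1) (ha : a ^ 2 ≤ m) (hb : b ^ 2 ≤ m) :
    balSq s a b ≤ m := by
  obtain ⟨h0, h1⟩ := hs
  have hm : 0 ≤ m := (sq_nonneg a).trans ha
  have key : √(((1 - s) * (a ^ 2 - b ^ 2) / 2) ^ 2 + (a * b) ^ 2) ≤
      m - (1 - s) * (a ^ 2 - b ^ 2) / 2 := by
    refine Real.sqrt_le_iff.2 ⟨?_, ?_⟩
    · nlinarith [sq_nonneg a, sq_nonneg b]
    · have : a ^ 2 * b ^ 2 ≤ m ^ 2 - m * ((1 - s) * (a ^ 2 - b ^ 2)) := by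
        rcases le_total (a ^ 2) (b ^ 2) with h | h
        · have : a ^ 2 * b ^ 2 ≤ m * m := mul_le_mul ha hb (sq_nonneg _) hm
          have : 0 ≤ m * ((1 - s) * (b ^ 2 - a ^ 2)) := by
            apply mul_nonneg hm (mul_nonneg (by linarith) (by linarith))
          nlinarith
        · have h3 : (1 - s) * (a ^ 2 - b ^ 2) ≤ a ^ 2 - b ^ 2 := by nlinarith
          have h4 : m * ((1 - s) * (a ^ 2 - b ^ 2)) ≤ m * (a ^ 2 - b ^ 2) :=
            mul_le_mul_of_nonneg_left h3 hm
          have : 0 ≤ (m - a ^ 2) * (m + b ^ 2) := mul_nonneg (by linarith) (by positivity)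
          nlinarith
      nlinarith
  unfold balSq; linarith

lemma balSq_eq_zero {s b : ℝ} (hs : s ≤ 1) : balSq s 0 b = 0 := by
  have : ((1 - s) * (0 ^ 2 - b ^ 2) / 2) ^ 2 + (0 * b) ^ 2 = ((1 - s) * b ^ 2 / 2) ^ 2 := by ring
  rw [balSq, this, Real.sqrt_sq (by have := sq_nonneg b; have : 0 ≤ 1 - s := by linarith
                                    positivity)]
  ring

/-- The coordinate `u_s`, with the phase of `u`. -/
def bal (s : ℝ) (u v : ℂ) : ℂ := (√(balSq s ‖u‖ ‖v‖) : ℂ) * phase u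

lemma bal_zero (u v : ℂ) : bal 0 u v = u := by
  rw [bal, balSq_zero, Real.sqrt_sq (norm_nonneg _), norm_mul_phase]

lemma bal_one (u v : ℂ) : bal 1 u v = √‖u * v‖ * phase u := by
  rw [bal, balSq_one (norm_nonneg _) (norm_nonneg _), norm_mul]

lemma bal_mul (s : ℝ) (u v : ℂ) : bal s u v * bal s v u = u * v := by
  have : (√(balSq s ‖u‖ ‖v‖) : ℂ) * √(balSq s ‖v‖ ‖u‖) = ‖u‖ * ‖v‖ := by
    rw [← Complex.ofReal_mul, ← Real.sqrt_mul (balSq_nonneg _ _ _), balSq_mul,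
      Real.sqrt_sq (by positivity)]
    push_cast; rfl
  calc _ = ((√(balSq s ‖u‖ ‖v‖) : ℂ) * √(balSq s ‖v‖ ‖u‖)) * (phase u * phase v) := by
        rw [bal, bal]; ring
    _ = (‖u‖ * phase u) * (‖v‖ * phase v) := by rw [this]; ring
    _ = u * v := by rw [norm_mul_phase, norm_mul_phase]

lemma sq_norm_bal_le {s m : ℝ} {u v : ℂ} (hs : s ∈ Set.Icc (0 : ℝ) 1) (hu : ‖u‖ ^ 2 ≤ m)
    (hv : ‖v‖ ^ 2 ≤ m) : ‖bal s u v‖ ^ 2 ≤ m := by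
  have h := balSq_le hs hu hv
  have h0 := balSq_nonneg s ‖u‖ ‖v‖
  have h1 : ‖bal s u v‖ ≤ √(balSq s ‖u‖ ‖v‖) := by
    rw [bal, norm_mul, Complex.norm_real, Real.norm_of_nonneg (Real.sqrt_nonneg _)]
    exact mul_le_of_le_one_right (Real.sqrt_nonneg _) (norm_phase_le _)
  calc ‖bal s u v‖ ^ 2 ≤ √(balSq s ‖u‖ ‖v‖) ^ 2 := by gcongr
    _ ≤ m := by rw [Real.sq_sqrt h0]; exact h

/-- The phase jumps only at `u = 0`, where the radius in front of it vanishes; this needs `s ≤ 1`.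
-/
lemma continuousOn_bal :
    ContinuousOn (fun w : ℝ × ℂ × ℂ => bal w.1 w.2.1 w.2.2) {w | w.1 ≤ 1} := by
  rintro ⟨s, u, v⟩ hs
  have hc : Continuous fun w : ℝ × ℂ × ℂ => (√(balSq w.1 ‖w.2.1‖ ‖w.2.2‖) : ℂ) := by
    have : Continuous fun w : ℝ × ℂ × ℂ => balSq w.1 ‖w.2.1‖ ‖w.2.2‖ :=
      continuous_balSq.comp (f := fun w : ℝ × ℂ × ℂ => (w.1, ‖w.2.1‖, ‖w.2.2‖)) (by fun_prop)
    fun_prop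
  rcases eq_or_ne u 0 with rfl | hu
  · refine continuousWithinAt_mul_of_zero hc.continuousWithinAt ?_ fun y => norm_phase_le _
    simp [balSq_eq_zero hs]
  · refine (hc.continuousAt.mul ?_).continuousWithinAt
    exact ContinuousAt.comp (f := fun w : ℝ × ℂ × ℂ => w.2.1) (continuousAt_phase hu) (by fun_prop)

/-! ### Monomials and the logarithm map -/

section Torus

variable {n : ℕ}

/-- The squared length of an integer vector. -/
def normSq (v : Fin n → ℤ) : ℝ := ∑ i, (v i : ℝ) ^ 2

/-- The dot product of integer vectors. -/
def dot (m γ : Fin n → ℤ) : ℤ := ∑ i, m i * γ i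

lemma pair_ivec (m γ : Fin n → ℤ) : pair m (ivec γ) = dot m γ := by
  simp [pair, ivec, dot]

lemma pair_add (m : Fin n → ℤ) (x y : Fin n → ℝ) : pair m (x + y) = pair m x + pair m y := by
  simp [pair, mul_add, Finset.sum_add_distrib]

lemma pair_smul (m : Fin n → ℤ) (s : ℝ) (x : Fin n → ℝ) : pair m (s • x) = s * pair m x := by
  simp only [pair, Pi.smul_apply, smul_eq_mul, Finset.mul_sum]
  exact Finset.sum_congr rfl fun i _ => by ring

lemma dot_self (v : Fin n → ℤ) : (dot v v : ℝ) = normSq v := by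
  simp [dot, normSq, sq]

lemma monom_ne_zero (m : Fin n → ℤ) {z : Fin n → ℂ} (hz : ∀ i, z i ≠ 0) : monom m z ≠ 0 :=
  Finset.prod_ne_zero_iff.2 fun i _ => zpow_ne_zero _ (hz i)

lemma monom_mul (m : Fin n → ℤ) (z w : Fin n → ℂ) :
    monom m (fun i => z i * w i) = monom m z * monom m w := by
  simp [monom, mul_zpow, Finset.prod_mul_distrib]

lemma monom_exp (m : Fin n → ℤ) (w : Fin n → ℂ) :
    monom m (fun i => Complex.exp (w i)) = Complex.exp (∑ i, m i * w i) := by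
  simp [monom, Complex.exp_sum, Complex.exp_int_mul]

lemma continuousAt_monom (m : Fin n → ℤ) {z : Fin n → ℂ} (hz : ∀ i, z i ≠ 0) :
    ContinuousAt (monom m) z := by
  unfold monom
  exact tendsto_finsetProd _ fun i _ =>
    (continuous_apply i).continuousAt.zpow₀ _ (Or.inl (hz i))

lemma norm_monom {t : ℝ} (ht : 0 < t) (ht1 : t < 1) (m : Fin n → ℤ) {z : Fin n → ℂ}
    (hz : ∀ i, z i ≠ 0) : ‖monom m z‖ = t ^ pair m (Logt t z) := by
  have hl : Real.log t ≠ 0 := (Real.log_neg ht ht1).ne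
  rw [monom, norm_prod, pair, Real.rpow_def_of_pos ht, Finset.mul_sum, Real.exp_sum]
  refine Finset.prod_congr rfl fun i _ => ?_
  have : Real.log t * (m i * Logt t z i) = m i * Real.log ‖z i‖ := by
    rw [Logt]; field_simp
  rw [this, norm_zpow, ← Real.rpow_intCast, Real.rpow_def_of_pos (norm_pos_iff.2 (hz i)), mul_comm]

lemma continuousAt_Logt (t : ℝ) {z : Fin n → ℂ} (hz : ∀ i, z i ≠ 0) :
    ContinuousAt (Logt t) z := by
  unfold Logt
  refine continuousAt_pi.2 fun i => ?_
  have h : Continuous fun z : Fin n → ℂ => ‖z i‖ := (continuous_apply i).norm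
  exact (h.continuousAt.log (norm_ne_zero_iff.2 (hz i))).div_const _

lemma Logt_exp (t : ℝ) (w : Fin n → ℂ) :
    Logt t (fun i => Complex.exp (w i)) = fun i => (w i).re / Real.log t := by
  funext i; simp [Logt, Complex.norm_exp]

lemma Logt_mul (t : ℝ) {z w : Fin n → ℂ} (hz : ∀ i, z i ≠ 0) (hw : ∀ i, w i ≠ 0) :
    Logt t (fun i => z i * w i) = Logt t z + Logt t w := by
  funext i
  simp [Logt, Real.log_mul (norm_ne_zero_iff.2 (hz i)) (norm_ne_zero_iff.2 (hw i)), add_div]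

lemma Logt_of_norm_one (t : ℝ) {w : Fin n → ℂ} (hw : ∀ i, ‖w i‖ = 1) : Logt t w = 0 := by
  funext i; simp [Logt, hw]

/-! ### The action of `ℂ* = ℝ × S¹` through `v` and `γ` -/

/-- The action of `(r, c)` by `exp(r v / |v|²) c^γ`. -/
def act (v γ : Fin n → ℤ) (r : ℝ) (c : ℂ) (z : Fin n → ℂ) : Fin n → ℂ :=
  fun i => z i * ((Real.exp (r * (v i / normSq v)) : ℝ) * c ^ γ i)

variable (v γ : Fin n → ℤ)

lemma act_ne_zero (r : ℝ) {c : ℂ} (hc : c ≠ 0) {z : Fin n → ℂ} (hz : ∀ i, z i ≠ 0) (i : Fin n) :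
    act v γ r c z i ≠ 0 :=
  mul_ne_zero (hz i) (mul_ne_zero (by exact_mod_cast (Real.exp_pos _).ne') (zpow_ne_zero _ hc))

lemma act_act (r r' : ℝ) (c c' : ℂ) (z : Fin n → ℂ) :
    act v γ r c (act v γ r' c' z) = act v γ (r + r') (c * c') z := by
  funext i
  simp only [act]
  rw [mul_zpow, add_mul, Real.exp_add]
  push_cast; ring

@[simp] lemma act_zero_one (z : Fin n → ℂ) : act v γ 0 1 z = z := by
  funext i; simp [act]

lemma monom_act (m : Fin n → ℤ) (r : ℝ) {c : ℂ} (hc : c ≠ 0) (z : Fin n → ℂ) :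
    monom m (act v γ r c z) =
      monom m z * ((Real.exp (r * (dot m v / normSq v)) : ℝ) * c ^ dot m γ) := by
  unfold act
  rw [monom_mul]
  congr 1
  rw [monom_mul]
  congr 1
  · have : r * (dot m v / normSq v) = ∑ i, m i * (r * (v i / normSq v)) := by
      rw [dot]; push_cast; rw [Finset.sum_div, Finset.mul_sum]
      exact Finset.sum_congr rfl fun i _ => by ring
    rw [this, Real.exp_sum]
    push_cast
    exact Finset.prod_congr rfl fun i _ => by rw [Complex.exp_int_mul]
  · have : ∀ s : Finset (Fin n), ∏ i ∈ s, (c ^ γ i) ^ m i = c ^ ∑ i ∈ s, m i * γ i := by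
      classical
      intro s
      induction s using Finset.induction_on with
      | empty => simp
      | insert a s ha ih =>
        rw [Finset.prod_insert ha, Finset.sum_insert ha, ih, zpow_add₀ hc, ← zpow_mul,
          mul_comm (γ a)]
    exact this _

lemma Logt_act (t r : ℝ) {c : ℂ} (hc : ‖c‖ = 1) {z : Fin n → ℂ} (hz : ∀ i, z i ≠ 0) :
    Logt t (act v γ r c z) = Logt t z + (r / Real.log t / normSq v) • ivec v := by
  have hc0 : c ≠ 0 := by rw [← norm_ne_zero_iff, hc]; exact one_ne_zero
  have h1 : ∀ i, ((Real.exp (r * (v i / normSq v)) : ℝ) : ℂ) ≠ 0 := fun i => by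
    exact_mod_cast (Real.exp_pos _).ne'
  unfold act
  rw [Logt_mul t hz fun i => mul_ne_zero (h1 i) (zpow_ne_zero _ hc0),
    Logt_mul t h1 fun i => zpow_ne_zero _ hc0,
    Logt_of_norm_one t (w := fun i => c ^ γ i) fun i => by simp [hc]]
  congr 1
  funext i
  simp only [Logt, Complex.norm_real, Real.norm_eq_abs, Real.abs_exp, Real.log_exp, ivec,
    Pi.add_apply, Pi.zero_apply, Pi.smul_apply, smul_eq_mul]
  ring

lemma continuousAt_act {X : Type*} [TopologicalSpace X] {r : X → ℝ} {c : X → ℂ}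
    {z : X → Fin n → ℂ} {x : X} (hr : ContinuousAt r x) (hc : ContinuousAt c x) (h0 : c x ≠ 0)
    (hz : ContinuousAt z x) : ContinuousAt (fun x => act v γ (r x) (c x) (z x)) x := by
  unfold act
  refine continuousAt_pi.2 fun i => ?_
  have h1 : ContinuousAt (fun x => c x ^ γ i) x := hc.zpow₀ _ (Or.inl h0)
  exact (continuousAt_pi.1 hz i).mul (ContinuousAt.mul (by fun_prop) h1)

end Torus

/-! ### Bounding the terms away from the facet -/

/-- Radial truncation of a complex number at modulus `M`. -/
def clamp (M : ℝ) (c : ℂ) : ℂ := ((min 1 (M / ‖c‖) : ℝ) : ℂ) * c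

lemma clamp_of_le {M : ℝ} {c : ℂ} (h : ‖c‖ ≤ M) : clamp M c = c := by
  rcases eq_or_ne c 0 with rfl | hc
  · simp [clamp]
  · rw [clamp, min_eq_left ((one_le_div (norm_pos_iff.2 hc)).2 h)]; simp

lemma norm_clamp_le {M : ℝ} (hM : 0 ≤ M) (c : ℂ) : ‖clamp M c‖ ≤ M := by
  rcases eq_or_ne c 0 with rfl | hc
  · simpa [clamp]
  · have h := norm_pos_iff.2 hc
    rw [clamp, norm_mul, Complex.norm_real, Real.norm_of_nonneg (by positivity)]
    calc _ ≤ M / ‖c‖ * ‖c‖ := by gcongr; exact min_le_right _ _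
      _ = M := by field_simp

lemma continuousAt_clamp (M : ℝ) {c : ℂ} (hc : c ≠ 0) : ContinuousAt (clamp M) c := by
  have : ‖c‖ ≠ 0 := norm_ne_zero_iff.2 hc
  have h : ContinuousAt (fun c : ℂ => min 1 (M / ‖c‖)) c :=
    Filter.Tendsto.min tendsto_const_nhds
      ((tendsto_const_nhds.div (continuous_norm.tendsto c) this))
  unfold clamp
  exact (Complex.continuous_ofReal.continuousAt.comp h).mul continuousAt_id

lemma norm_exp_sub_exp_le {M : ℝ} {a b : ℂ} (ha : a.re ≤ M) (hb : b.re ≤ M) :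
    ‖Complex.exp a - Complex.exp b‖ ≤ Real.exp M * ‖a - b‖ := by
  refine (convex_halfSpace_re_le M).norm_image_sub_le_of_norm_deriv_le
    (f := Complex.exp) (C := Real.exp M) (fun x _ => Complex.differentiableAt_exp) ?_ hb ha
  intro x hx
  rw [Complex.deriv_exp, Complex.norm_exp]
  exact Real.exp_le_exp.2 hx

/-- In logarithmic coordinates truncation caps the real part at `log M`, a 1-Lipschitz operation.
This turns the next estimate into one for `exp` on a half plane. -/
lemma clamp_mul_exp {M : ℝ} (hM : 0 < M) {c : ℂ} (hc : c ≠ 0) (ζ : ℂ) :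
    clamp M (c * Complex.exp ζ) = phase c *
      Complex.exp (⟨min (Real.log ‖c‖ + ζ.re) (Real.log M), ζ.im⟩ : ℂ) := by
  have h := norm_pos_iff.2 hc
  have hn : ‖c * Complex.exp ζ‖ = Real.exp (Real.log ‖c‖ + ζ.re) := by
    rw [norm_mul, Complex.norm_exp, Real.exp_add, Real.exp_log h]
  have h1 : min 1 (M / ‖c * Complex.exp ζ‖) =
      Real.exp (min (Real.log ‖c‖ + ζ.re) (Real.log M)) / Real.exp (Real.log ‖c‖ + ζ.re) := by
    rw [hn, (Real.exp_strictMono.monotone).map_min, Real.exp_log hM,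
      ← min_div_div_right (Real.exp_pos _).le, div_self (Real.exp_pos _).ne']
  have h2 : Complex.exp ζ = Real.exp ζ.re * Complex.exp (ζ.im * Complex.I) := by
    conv_lhs => rw [← Complex.re_add_im ζ]
    rw [Complex.exp_add]; simp
  have h3 : Complex.exp (⟨min (Real.log ‖c‖ + ζ.re) (Real.log M), ζ.im⟩ : ℂ) =
      Real.exp (min (Real.log ‖c‖ + ζ.re) (Real.log M)) * Complex.exp (ζ.im * Complex.I) := by
    conv_lhs => rw [Complex.mk_eq_add_mul_I]
    rw [Complex.exp_add]; simp
  rw [clamp, h1, h3, h2, Real.exp_add, Real.exp_log h, phase]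
  have h4 : (‖c‖ : ℂ) ≠ 0 := by exact_mod_cast h.ne'
  have h5 : ((Real.exp ζ.re : ℝ) : ℂ) ≠ 0 := by exact_mod_cast (Real.exp_pos _).ne'
  push_cast at h5 ⊢
  field_simp

lemma norm_clamp_mul_exp_sub_le {M : ℝ} (hM : 0 < M) {c : ℂ} (hc : c ≠ 0) (ζ ζ' : ℂ) :
    ‖clamp M (c * Complex.exp ζ) - clamp M (c * Complex.exp ζ')‖ ≤
      M * (|ζ.re - ζ'.re| + |ζ.im - ζ'.im|) := by
  rw [clamp_mul_exp hM hc, clamp_mul_exp hM hc, ← mul_sub, norm_mul, norm_phase hc, one_mul]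
  refine (norm_exp_sub_exp_le (M := Real.log M) (min_le_right _ _) (min_le_right _ _)).trans ?_
  rw [Real.exp_log hM]
  gcongr
  refine (Complex.norm_le_abs_re_add_abs_im _).trans ?_
  simp only [Complex.sub_re, Complex.sub_im]
  refine add_le_add ?_ le_rfl
  have := abs_min_sub_min_le_max (Real.log ‖c‖ + ζ.re) (Real.log M) (Real.log ‖c‖ + ζ'.re)
    (Real.log M)
  simpa using this

/-- The derivative `1 / (1 + x)` is at most `2` on the ball of radius `1/2`. -/
lemma norm_log_sub_log_le {a b : ℂ} (ha : ‖a‖ ≤ 1 / 2) (hb : ‖b‖ ≤ 1 / 2) :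
    ‖Complex.log (1 + a) - Complex.log (1 + b)‖ ≤ 2 * ‖a - b‖ := by
  have hre : ∀ x ∈ Metric.closedBall (0 : ℂ) (1 / 2), 1 + x ∈ Complex.slitPlane := by
    intro x hx
    left
    have h1 := (Complex.abs_re_le_norm x).trans (mem_closedBall_zero_iff.1 hx)
    have h2 := neg_abs_le x.re
    simp only [Complex.add_re, Complex.one_re]; linarith
  refine (convex_closedBall (0 : ℂ) (1 / 2)).norm_image_sub_le_of_norm_hasDerivWithin_le
    (f := fun x => Complex.log (1 + x)) (f' := fun x => 1 / (1 + x)) ?_ ?_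
    (mem_closedBall_zero_iff.2 hb) (mem_closedBall_zero_iff.2 ha)
  · intro x hx
    exact (((hasDerivAt_id x).const_add 1).clog (hre x hx)).hasDerivWithinAt
  · intro x hx
    have h1 : 1 - ‖x‖ ≤ ‖1 + x‖ := by
      have := norm_sub_norm_le (1 : ℂ) (-x)
      simpa using this
    have h2 : (1 / 2 : ℝ) ≤ ‖1 + x‖ := by have := mem_closedBall_zero_iff.1 hx; linarith
    rw [norm_div, norm_one, div_le_iff₀ (by linarith)]; linarith

lemma norm_log_one_add_le' {a : ℂ} (ha : ‖a‖ ≤ 1 / 2) : ‖Complex.log (1 + a)‖ ≤ 2 * ‖a‖ := by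
  simpa using norm_log_sub_log_le ha (b := 0) (by simp)

variable {n p : ℕ} {P : Potential n p} {j : Fin p}

lemma Potential.term_ne_zero (P : Potential n p) {t : ℝ} (ht : 0 < t) (k : Fin p)
    {z : Fin n → ℂ} (hz : ∀ i, z i ≠ 0) : P.term t k z ≠ 0 :=
  mul_ne_zero (by exact_mod_cast (Real.rpow_pos_of_pos ht _).ne') (monom_ne_zero _ hz)

lemma Potential.norm_term (P : Potential n p) {t : ℝ} (ht : 0 < t) (ht1 : t < 1) (k : Fin p)
    {z : Fin n → ℂ} (hz : ∀ i, z i ≠ 0) : ‖P.term t k z‖ = t ^ P.chi k (Logt t z) := by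
  rw [Potential.term, norm_mul, norm_monom ht ht1 _ hz, Complex.norm_real,
    Real.norm_of_nonneg (Real.rpow_nonneg ht.le _), ← Real.rpow_add ht, Potential.chi]

lemma Potential.term_act (P : Potential n p) (v γ : Fin n → ℤ) (t r : ℝ) (k : Fin p) {c : ℂ}
    (hc : c ≠ 0) (z : Fin n → ℂ) : P.term t k (act v γ r c z) =
      P.term t k z * ((Real.exp (r * (dot (P.v k) v / normSq v)) : ℝ) * c ^ dot (P.v k) γ) := by
  rw [Potential.term, monom_act _ _ _ _ hc, Potential.term]; ring

lemma Potential.continuousAt_term (P : Potential n p) (t : ℝ) (k : Fin p) {z : Fin n → ℂ}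
    (hz : ∀ i, z i ≠ 0) : ContinuousAt (P.term t k) z :=
  continuousAt_const.mul (continuousAt_monom _ hz)

lemma Potential.continuousAt_W (P : Potential n p) (t : ℝ) {z : Fin n → ℂ}
    (hz : ∀ i, z i ≠ 0) : ContinuousAt (P.W t) z :=
  continuousAt_const.add (tendsto_finsetSum _ fun k _ => P.continuousAt_term t k hz)

/-! ### The small part of the potential, and the zeros of `W` along orbits -/

namespace FacetNbhd

variable (N : FacetNbhd P j)

/-- The terms `k ≠ j` of the potential, truncated at `t^{c_k}`; over `U` the truncation does
nothing. -/
def rest (t : ℝ) (z : Fin n → ℂ) : ℂ :=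
  ∑ k ∈ Finset.univ.erase j, clamp (t ^ N.c k) (P.term t k z)

/-- An upper bound for the size of `rest`. -/
def restBound (t : ℝ) : ℝ := ∑ k ∈ Finset.univ.erase j, t ^ N.c k

/-- An upper bound for the Lipschitz constant of `rest` along the orbits of the action. -/
def restLip (γ : Fin n → ℤ) (t : ℝ) : ℝ :=
  ∑ k ∈ Finset.univ.erase j, t ^ N.c k *
    (|(dot (P.v k) (P.v j) : ℝ) / normSq (P.v j)| + |(dot (P.v k) γ : ℝ)|)

/-- The action of `w ∈ ℂ` by `exp(Re w · v_j / |v_j|² + √-1 Im w · γ)`. -/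
def actC (_ : FacetNbhd P j) (γ : Fin n → ℤ) (w : ℂ) (z : Fin n → ℂ) : Fin n → ℂ :=
  act (P.v j) γ w.re (Complex.exp (Complex.I * (w.im : ℂ))) z

variable {t : ℝ}

lemma rest_eq (ht : 0 < t) (ht1 : t < 1) {z : Fin n → ℂ} (hz : ∀ i, z i ≠ 0)
    (hU : Logt t z ∈ N.U) : N.rest t z = ∑ k ∈ Finset.univ.erase j, P.term t k z := by
  refine Finset.sum_congr rfl fun k hk => clamp_of_le ?_
  rw [P.norm_term ht ht1 k hz]
  exact Real.rpow_le_rpow_of_exponent_ge ht ht1.le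
    (N.lt_chi _ hU k (Finset.ne_of_mem_erase hk)).le

lemma W_eq (ht : 0 < t) (ht1 : t < 1) {z : Fin n → ℂ} (hz : ∀ i, z i ≠ 0)
    (hU : Logt t z ∈ N.U) : P.W t z = 1 + P.term t j z + N.rest t z := by
  rw [N.rest_eq ht ht1 hz hU, Potential.W, ← Finset.add_sum_erase _ _ (Finset.mem_univ j)]; ring

lemma norm_rest_le (ht : 0 < t) (z : Fin n → ℂ) : ‖N.rest t z‖ ≤ N.restBound t :=
  (norm_sum_le _ _).trans (Finset.sum_le_sum fun _ _ =>
    norm_clamp_le (Real.rpow_nonneg ht.le _) _)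

lemma continuousAt_rest (ht : 0 < t) {z : Fin n → ℂ} (hz : ∀ i, z i ≠ 0) :
    ContinuousAt (N.rest t) z := by
  refine tendsto_finsetSum _ fun k _ => ?_
  exact ContinuousAt.comp (g := clamp (t ^ N.c k)) (continuousAt_clamp _ (P.term_ne_zero ht k hz))
    (P.continuousAt_term t k hz)

variable {γ : Fin n → ℤ}

lemma term_actC (k : Fin p) (w : ℂ) (z : Fin n → ℂ) :
    P.term t k (N.actC γ w z) = P.term t k z * Complex.exp
      ⟨w.re * (dot (P.v k) (P.v j) / normSq (P.v j)), w.im * dot (P.v k) γ⟩ := by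
  rw [actC, P.term_act _ _ _ _ _ (Complex.exp_ne_zero _), Complex.mk_eq_add_mul_I, Complex.exp_add,
    Complex.ofReal_exp, ← Complex.exp_int_mul]
  congr 3
  push_cast; ring

/-- Each term is multiplied by the exponential of a real-linear function of `w`. Because the terms
are truncated, the estimate holds for all `w`, even when the orbit leaves the region over `U`. -/
lemma norm_rest_actC_sub_le (ht : 0 < t) {z : Fin n → ℂ} (hz : ∀ i, z i ≠ 0) (w w' : ℂ) :
    ‖N.rest t (N.actC γ w z) - N.rest t (N.actC γ w' z)‖ ≤ N.restLip γ t * ‖w - w'‖ := by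
  rw [rest, rest, ← Finset.sum_sub_distrib, restLip, Finset.sum_mul]
  refine (norm_sum_le _ _).trans (Finset.sum_le_sum fun k _ => ?_)
  rw [term_actC, term_actC]
  refine (norm_clamp_mul_exp_sub_le (Real.rpow_pos_of_pos ht _) (P.term_ne_zero ht k hz) _ _).trans ?_
  rw [mul_assoc]
  refine mul_le_mul_of_nonneg_left ?_ (Real.rpow_nonneg ht.le _)
  rw [← sub_mul, ← sub_mul, abs_mul, abs_mul, add_mul, mul_comm |w.re - w'.re|,
    mul_comm |w.im - w'.im|]
  have h1 := Complex.abs_re_le_norm (w - w')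
  have h2 := Complex.abs_im_le_norm (w - w')
  rw [Complex.sub_re] at h1
  rw [Complex.sub_im] at h2
  gcongr

/-- `root y` is the unique solution `w` close to `0` of `e^w = 1 + rest(w · y)`, and it depends
continuously on `y`. -/
def IsRootMap (γ : Fin n → ℤ) (t : ℝ) (root : (Fin n → ℂ) → ℂ) : Prop :=
  ∀ y : Fin n → ℂ, (∀ i, y i ≠ 0) →
    ‖root y‖ ≤ 2 * N.restBound t ∧
    Complex.exp (root y) = 1 + N.rest t (N.actC γ (root y) y) ∧
    (∀ w : ℂ, -Real.pi < w.im → w.im ≤ Real.pi →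
      Complex.exp w = 1 + N.rest t (N.actC γ w y) → w = root y) ∧
    ContinuousAt root y

/-- For small `t` there is a root map. -/
lemma exists_root (ht : 0 < t) (hG : N.restBound t ≤ 1 / 10) (hL : N.restLip γ t ≤ 1 / 4) :
    ∃ root : (Fin n → ℂ) → ℂ, N.IsRootMap γ t root := by
  set T : (Fin n → ℂ) → ℂ → ℂ := fun y w => Complex.log (1 + N.rest t (N.actC γ w y)) with hT
  have hr : ∀ z, ‖N.rest t z‖ ≤ 1 / 2 := fun z => (N.norm_rest_le ht z).trans (by linarith)
  -- The ratio `1/2` is the Lipschitz constant `2` of the logarithm times the bound `1/4` on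
  -- `restLip`.
  have hC : ∀ y : Fin n → ℂ, (∀ i, y i ≠ 0) → ContractingWith (1 / 2) (T y) := by
    intro y hy
    refine ⟨by simp only [one_div]; exact NNReal.inv_lt_one_iff two_ne_zero |>.2 (by norm_num),
      LipschitzWith.of_dist_le_mul fun w w' => ?_⟩
    rw [dist_eq_norm, dist_eq_norm]
    refine (norm_log_sub_log_le (hr _) (hr _)).trans ?_
    have := N.norm_rest_actC_sub_le (γ := γ) ht hy w w'
    have h2 : N.restLip γ t * ‖w - w'‖ ≤ 1 / 4 * ‖w - w'‖ := by gcongr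
    push_cast
    linarith
  have hex : ∀ y : Fin n → ℂ, ∃ w, (∀ i, y i ≠ 0) → T y w = w := by
    intro y
    by_cases hy : ∀ i, y i ≠ 0
    · exact ⟨_, fun _ => (hC y hy).fixedPoint_isFixedPt⟩
    -- The value off the torus is arbitrary.
    · exact ⟨0, fun h => absurd h hy⟩
  choose root hroot using hex
  refine ⟨root, fun y hy => ⟨?_, ?_, ?_, ?_⟩⟩
  · rw [← hroot y hy]
    exact (norm_log_one_add_le' (hr _)).trans (by gcongr; exact N.norm_rest_le ht _)
  · conv_lhs => rw [← hroot y hy]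
    refine Complex.exp_log fun h0 => ?_
    have h1 := hr (N.actC γ (root y) y)
    rw [eq_neg_of_add_eq_zero_right h0, norm_neg, norm_one] at h1
    norm_num at h1
  · intro w h1 h2 hw
    -- The bounds on `w.im` put `w` in the range of the principal logarithm, so a solution of the
    -- exponential equation is a fixed point.
    refine (hC y hy).fixedPoint_unique' ?_ (hroot y hy)
    change Complex.log _ = w
    rw [← hw, Complex.log_exp h1 h2]
  · have hcont : ContinuousAt (fun y' => T y' (root y)) y := by
      have hne := fun i => act_ne_zero (P.v j) γ (root y).re
        (Complex.exp_ne_zero (Complex.I * ((root y).im : ℂ))) hy i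
      have h1 : ContinuousAt (fun y' => N.actC γ (root y) y') y :=
        continuousAt_act _ _ continuousAt_const continuousAt_const (Complex.exp_ne_zero _)
          continuousAt_id
      have h2 : ContinuousAt (fun y' => N.rest t (N.actC γ (root y) y')) y :=
        ContinuousAt.comp (g := N.rest t) (N.continuousAt_rest ht hne) h1
      refine ContinuousAt.clog (continuousAt_const.add h2) ?_
      left
      have h3 := (Complex.abs_re_le_norm _).trans (hr (N.actC γ (root y) y))
      have h4 := neg_abs_le (N.rest t (N.actC γ (root y) y)).re
      simp only [Complex.add_re, Complex.one_re]; linarith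
    have hev : ∀ᶠ y' in nhds y, ∀ i, y' i ≠ 0 :=
      Filter.eventually_all.2 fun i => (continuous_apply i).continuousAt.eventually_ne (hy i)
    rw [ContinuousAt, tendsto_iff_dist_tendsto_zero]
    have h0 : Filter.Tendsto (fun y' => 2 * dist (T y' (root y)) (root y)) (nhds y) (nhds 0) := by
      have := (tendsto_iff_dist_tendsto_zero.1 hcont.tendsto).const_mul 2
      simpa [hroot y hy] using this
    refine squeeze_zero' (Filter.Eventually.of_forall fun _ => dist_nonneg) ?_ h0
    filter_upwards [hev] with y' hy'
    -- For a map of ratio `1/2` the distance to the fixed point is at most twice the first step; at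
    -- `root y` that step tends to `0` as `y'` tends to `y`.
    have h1 := (hC y' hy').dist_le_of_fixedPoint (root y) (hroot y' hy')
    rw [dist_comm, dist_comm (T y' (root y))]
    refine h1.trans (le_of_eq ?_)
    push_cast
    ring

end FacetNbhd

lemma dot_comm (m γ : Fin n → ℤ) : dot m γ = dot γ m := by simp [dot, mul_comm]

lemma normSq_pos {v γ : Fin n → ℤ} (h : dot v γ = 1) : 0 < normSq v := by
  have h0 : 0 ≤ normSq v := Finset.sum_nonneg fun i _ => sq_nonneg _
  refine lt_of_le_of_ne h0 fun h1 => ?_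
  have h2 : ∀ i, v i = 0 := fun i => by
    have := (Finset.sum_eq_zero_iff_of_nonneg fun i _ => sq_nonneg ((v i : ℤ) : ℝ)).1 h1.symm i
      (Finset.mem_univ i)
    exact_mod_cast pow_eq_zero_iff two_ne_zero |>.1 this
  simp [dot, h2] at h

/-- Moving `Log_t y` to `(1 - s) Log_t y + s a`, with the angles fixed. -/
def slide (t : ℝ) (a : Fin n → ℝ) (s : ℝ) (y : Fin n → ℂ) : Fin n → ℂ :=
  fun i => y i * Complex.exp ((Real.log t * (s * (a i - Logt t y i)) : ℝ) : ℂ)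

/-! ### Moving flat points parallel to the facet -/

section slide

variable {t : ℝ} (a : Fin n → ℝ)

lemma slide_ne_zero (s : ℝ) {y : Fin n → ℂ} (hy : ∀ i, y i ≠ 0) (i : Fin n) :
    slide t a s y i ≠ 0 := mul_ne_zero (hy i) (Complex.exp_ne_zero _)

@[simp] lemma slide_zero (y : Fin n → ℂ) : slide t a 0 y = y := by
  funext i; simp [slide]

lemma Logt_slide (ht : 0 < t) (ht1 : t < 1) (s : ℝ) {y : Fin n → ℂ} (hy : ∀ i, y i ≠ 0) :
    Logt t (slide t a s y) = (1 - s) • Logt t y + s • a := by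
  have hl : Real.log t ≠ 0 := (Real.log_neg ht ht1).ne
  unfold slide
  rw [Logt_mul t hy fun i => Complex.exp_ne_zero _, Logt_exp]
  funext i
  simp only [Pi.add_apply, Complex.ofReal_re, Pi.smul_apply, smul_eq_mul]
  field_simp
  ring

lemma continuousAt_slide (s : ℝ) {y : Fin n → ℂ} (hy : ∀ i, y i ≠ 0) :
    ContinuousAt (fun w : ℝ × (Fin n → ℂ) => slide t a w.1 w.2) (s, y) := by
  unfold slide
  refine continuousAt_pi.2 fun i => ?_
  have h1 : ContinuousAt (fun w : ℝ × (Fin n → ℂ) => Logt t w.2 i) (s, y) :=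
    ContinuousAt.comp (g := fun y : Fin n → ℂ => Logt t y i)
      (continuousAt_pi.1 (continuousAt_Logt t hy) i) continuousAt_snd
  have h2 : ContinuousAt (fun w : ℝ × (Fin n → ℂ) => w.2 i) (s, y) := by fun_prop
  exact h2.mul (by fun_prop)

/-- The value `-1` forces `χ_j(Log_t y) = 0 = χ_j(a)`, so the displacement pairs to zero with `v_j`
and the monomial does not change. -/
lemma term_slide (ht : 0 < t) (ht1 : t < 1) (ha : P.chi j a = 0) (s : ℝ) {y : Fin n → ℂ}
    (hy : ∀ i, y i ≠ 0) (hT : P.term t j y = -1) : P.term t j (slide t a s y) = -1 := by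
  have h1 : P.chi j (Logt t y) = 0 := by
    have h := P.norm_term ht ht1 j hy
    rw [hT, norm_neg, norm_one, Real.rpow_def_of_pos ht, eq_comm, Real.exp_eq_one_iff] at h
    exact (mul_eq_zero.1 h).resolve_left (Real.log_neg ht ht1).ne
  have h2 : monom (P.v j) (slide t a s y) = monom (P.v j) y := by
    unfold slide
    rw [monom_mul, monom_exp]
    have : ∑ i, ((P.v j i : ℤ) : ℂ) * ((Real.log t * (s * (a i - Logt t y i)) : ℝ) : ℂ) =
        ((Real.log t * s * (pair (P.v j) a - pair (P.v j) (Logt t y)) : ℝ) : ℂ) := by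
      rw [pair, pair, ← Finset.sum_sub_distrib, Finset.mul_sum]
      push_cast
      exact Finset.sum_congr rfl fun i _ => by ring
    have h3 : pair (P.v j) a - pair (P.v j) (Logt t y) = 0 := by
      simp only [Potential.chi] at h1 ha; linarith
    rw [this, h3]; simp
  rw [Potential.term, h2]; exact hT

end slide

/-! ### The flat point of an orbit -/

namespace FacetNbhd

variable (N : FacetNbhd P j) {γ : Fin n → ℤ} {t : ℝ}

/-- The point of the orbit of `z` at which the `j`-th term is `-1`. -/
def flat (_ : FacetNbhd P j) (γ : Fin n → ℤ) (t : ℝ) (z : Fin n → ℂ) : Fin n → ℂ :=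
  act (P.v j) γ (-Real.log ‖P.term t j z‖) (-phase (P.term t j z))⁻¹ z

/-- This explains the normalisation of `act`: dividing by `|v_j|²` and choosing `γ` dual to `v_j`
makes the action multiply the `j`-th term by exactly `e^r c`. -/
lemma term_act_self (hγ : dot (P.v j) γ = 1) (r : ℝ) {c : ℂ} (hc : c ≠ 0) (z : Fin n → ℂ) :
    P.term t j (act (P.v j) γ r c z) = P.term t j z * (Real.exp r * c) := by
  rw [P.term_act _ _ _ _ _ hc, hγ, dot_self, div_self (normSq_pos hγ).ne', mul_one, zpow_one]

lemma neg_phase_term_ne_zero (ht : 0 < t) {z : Fin n → ℂ} (hz : ∀ i, z i ≠ 0) :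
    -phase (P.term t j z) ≠ 0 := neg_ne_zero.2 (phase_ne_zero (P.term_ne_zero ht j hz))

lemma norm_neg_phase_term (ht : 0 < t) {z : Fin n → ℂ} (hz : ∀ i, z i ≠ 0) :
    ‖-phase (P.term t j z)‖ = 1 := by rw [norm_neg, norm_phase (P.term_ne_zero ht j hz)]

lemma flat_ne_zero (ht : 0 < t) {z : Fin n → ℂ} (hz : ∀ i, z i ≠ 0) (i : Fin n) :
    N.flat γ t z i ≠ 0 :=
  act_ne_zero _ _ _ (inv_ne_zero (neg_phase_term_ne_zero ht hz)) hz i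

lemma term_flat (hγ : dot (P.v j) γ = 1) (ht : 0 < t) {z : Fin n → ℂ} (hz : ∀ i, z i ≠ 0) :
    P.term t j (N.flat γ t z) = -1 := by
  have hT := P.term_ne_zero ht j hz
  have h1 := phase_ne_zero hT
  have h2 : (‖P.term t j z‖ : ℂ) ≠ 0 := by exact_mod_cast norm_ne_zero_iff.2 hT
  rw [flat, term_act_self hγ _ (inv_ne_zero (neg_phase_term_ne_zero ht hz)), Real.exp_neg,
    Real.exp_log (norm_pos_iff.2 hT)]
  nth_rewrite 1 [← norm_mul_phase (P.term t j z)]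
  push_cast
  rw [inv_neg]
  field_simp

lemma act_flat (ht : 0 < t) {z : Fin n → ℂ} (hz : ∀ i, z i ≠ 0) :
    act (P.v j) γ (Real.log ‖P.term t j z‖) (-phase (P.term t j z)) (N.flat γ t z) = z := by
  rw [flat, act_act, add_neg_cancel, mul_inv_cancel₀ (neg_phase_term_ne_zero ht hz), act_zero_one]

lemma Logt_flat (ht : 0 < t) {z : Fin n → ℂ} (hz : ∀ i, z i ≠ 0) :
    Logt t (N.flat γ t z) = Logt t z +
      (-Real.log ‖P.term t j z‖ / Real.log t / normSq (P.v j)) • ivec (P.v j) := by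
  rw [flat, Logt_act _ _ _ _ (by rw [norm_inv, norm_neg_phase_term ht hz, inv_one]) hz]

lemma continuousAt_phase_term (ht : 0 < t) {z : Fin n → ℂ} (hz : ∀ i, z i ≠ 0) :
    ContinuousAt (fun z => phase (P.term t j z)) z :=
  ContinuousAt.comp (g := phase) (continuousAt_phase (P.term_ne_zero ht j hz))
    (P.continuousAt_term t j hz)

lemma continuousAt_log_term (ht : 0 < t) {z : Fin n → ℂ} (hz : ∀ i, z i ≠ 0) :
    ContinuousAt (fun z => Real.log ‖P.term t j z‖) z :=
  (P.continuousAt_term t j hz).norm.log (norm_ne_zero_iff.2 (P.term_ne_zero ht j hz))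

lemma continuousAt_flat (ht : 0 < t) {z : Fin n → ℂ} (hz : ∀ i, z i ≠ 0) :
    ContinuousAt (N.flat γ t) z := by
  have h0 := neg_phase_term_ne_zero (P := P) (j := j) ht hz
  exact continuousAt_act _ _ (continuousAt_log_term ht hz).neg
    ((continuousAt_phase_term ht hz).neg.inv₀ h0) (inv_ne_zero h0) continuousAt_id

lemma actC_ne_zero (w : ℂ) {y : Fin n → ℂ} (hy : ∀ i, y i ≠ 0) (i : Fin n) :
    N.actC γ w y i ≠ 0 := act_ne_zero _ _ _ (Complex.exp_ne_zero _) hy i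

lemma term_actC_self (hγ : dot (P.v j) γ = 1) (w : ℂ) (y : Fin n → ℂ) :
    P.term t j (N.actC γ w y) = P.term t j y * Complex.exp w := by
  rw [actC, term_act_self hγ _ (Complex.exp_ne_zero _), Complex.ofReal_exp, ← Complex.exp_add]
  congr 2
  conv_rhs => rw [← Complex.re_add_im w, mul_comm]

variable {N} {root : (Fin n → ℂ) → ℂ}

lemma IsRootMap.W_eq_zero (hroot : N.IsRootMap γ t root) (hγ : dot (P.v j) γ = 1)
    (ht : 0 < t) (ht1 : t < 1) {y : Fin n → ℂ} (hy : ∀ i, y i ≠ 0) (hT : P.term t j y = -1)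
    (hU : Logt t (N.actC γ (root y) y) ∈ N.U) :
    P.W t (N.actC γ (root y) y) = 0 := by
  rw [N.W_eq ht ht1 (N.actC_ne_zero _ hy) hU, N.term_actC_self hγ, hT, (hroot y hy).2.1]
  ring

end FacetNbhd

/-! ### The motion of the base that preserves the zeros of `W` -/

namespace FacetNbhd

section baseMove

variable (N : FacetNbhd P j) (γ : Fin n → ℤ) (t : ℝ) (root : (Fin n → ℂ) → ℂ) (a : Fin n → ℝ)

/-- The phase of `z^{v_j}`, normalised to be `1` where `W = 0`. -/
def relPhase (z : Fin n → ℂ) : ℂ :=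
  -phase (P.term t j z) * Complex.exp (Complex.I * ((-(root (N.flat γ t z)).im : ℝ) : ℂ))

/-- The flat representative, moved towards `Log_t⁻¹(a)`. -/
def flatMove (s : ℝ) (z : Fin n → ℂ) : Fin n → ℂ := slide t a s (N.flat γ t z)

/-- A motion of `Log_t⁻¹(U)` into the torus over `a` spanned by the zeros of `W`, which preserves
the zero locus of `W`. -/
def baseMove (s : ℝ) (z : Fin n → ℂ) : Fin n → ℂ :=
  act (P.v j) γ
    ((1 - s) * (Real.log ‖P.term t j z‖ - (root (N.flat γ t z)).re) +
      (root (N.flatMove γ t a s z)).re)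
    (twist (2 * s) (N.relPhase γ t root z) *
      Complex.exp (Complex.I * ((root (N.flatMove γ t a s z)).im : ℂ)))
    (N.flatMove γ t a s z)

variable {N γ t root a}

lemma norm_relPhase (ht : 0 < t) {z : Fin n → ℂ} (hz : ∀ i, z i ≠ 0) :
    ‖N.relPhase γ t root z‖ = 1 := by
  rw [relPhase, norm_mul, norm_neg_phase_term ht hz, norm_exp_I_mul, one_mul]

lemma flatMove_ne_zero (ht : 0 < t) (s : ℝ) {z : Fin n → ℂ} (hz : ∀ i, z i ≠ 0) (i : Fin n) :
    N.flatMove γ t a s z i ≠ 0 := slide_ne_zero a s (N.flat_ne_zero ht hz) i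

lemma norm_baseMove_phase (ht : 0 < t) (s : ℝ) {z : Fin n → ℂ} (hz : ∀ i, z i ≠ 0) (w : ℝ) :
    ‖twist (2 * s) (N.relPhase γ t root z) * Complex.exp (Complex.I * (w : ℂ))‖ = 1 := by
  rw [norm_mul, norm_twist, norm_relPhase ht hz, norm_exp_I_mul, one_mul]

lemma baseMove_phase_ne_zero (ht : 0 < t) (s : ℝ) {z : Fin n → ℂ} (hz : ∀ i, z i ≠ 0) (w : ℝ) :
    twist (2 * s) (N.relPhase γ t root z) * Complex.exp (Complex.I * (w : ℂ)) ≠ 0 := by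
  rw [← norm_ne_zero_iff, norm_baseMove_phase ht s hz]; exact one_ne_zero

lemma baseMove_ne_zero (ht : 0 < t) (s : ℝ) {z : Fin n → ℂ} (hz : ∀ i, z i ≠ 0) (i : Fin n) :
    N.baseMove γ t root a s z i ≠ 0 :=
  act_ne_zero _ _ _ (baseMove_phase_ne_zero ht s hz _) (flatMove_ne_zero ht s hz) i

lemma baseMove_zero (ht : 0 < t) {z : Fin n → ℂ} (hz : ∀ i, z i ≠ 0) :
    N.baseMove γ t root a 0 z = z := by
  have h : N.flatMove γ t a 0 z = N.flat γ t z := slide_zero _ _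
  have h2 : Complex.exp (Complex.I * ((-(root (N.flat γ t z)).im : ℝ) : ℂ)) *
      Complex.exp (Complex.I * ((root (N.flat γ t z)).im : ℂ)) = 1 := by
    rw [← Complex.exp_add]; simp
  rw [baseMove, h, mul_zero, twist_zero_left, relPhase, mul_assoc, h2]
  simpa using N.act_flat (γ := γ) ht hz

lemma baseMove_one (z : Fin n → ℂ) : N.baseMove γ t root a 1 z =
    act (P.v j) γ 0 (twist 2 (N.relPhase γ t root z))
      (N.actC γ (root (N.flatMove γ t a 1 z)) (N.flatMove γ t a 1 z)) := by
  rw [actC, act_act, baseMove, sub_self, zero_mul, mul_one]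

lemma Logt_flatMove_one (ht : 0 < t) (ht1 : t < 1) {z : Fin n → ℂ} (hz : ∀ i, z i ≠ 0) :
    Logt t (N.flatMove γ t a 1 z) = a := by
  rw [flatMove, Logt_slide a ht ht1 1 (N.flat_ne_zero ht hz)]; simp

lemma term_flatMove (hγ : dot (P.v j) γ = 1) (ht : 0 < t) (ht1 : t < 1) (ha : P.chi j a = 0)
    (s : ℝ) {z : Fin n → ℂ} (hz : ∀ i, z i ≠ 0) : P.term t j (N.flatMove γ t a s z) = -1 :=
  term_slide a ht ht1 ha s (N.flat_ne_zero ht hz) (N.term_flat hγ ht hz)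

/-- The shift from `z` to its flat point cancels, so the motion follows the straight segment to `a`
up to a multiple of `v_j` controlled by two values of `root`. -/
lemma Logt_baseMove (ht : 0 < t) (ht1 : t < 1) (s : ℝ) {z : Fin n → ℂ} (hz : ∀ i, z i ≠ 0) :
    Logt t (N.baseMove γ t root a s z) = ((1 - s) • Logt t z + s • a) +
      ((-(1 - s) * (root (N.flat γ t z)).re + (root (N.flatMove γ t a s z)).re) / Real.log t /
        normSq (P.v j)) • ivec (P.v j) := by
  rw [baseMove, Logt_act _ _ _ _ (norm_baseMove_phase ht s hz _) (flatMove_ne_zero ht s hz),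
    flatMove, Logt_slide a ht ht1 s (N.flat_ne_zero ht hz), N.Logt_flat ht hz]
  funext i
  simp only [Pi.add_apply, Pi.smul_apply, smul_eq_mul]
  ring

lemma IsRootMap.relPhase_eq_one (hroot : N.IsRootMap γ t root) (ht : 0 < t) (ht1 : t < 1)
    {z : Fin n → ℂ} (hz : ∀ i, z i ≠ 0) (hU : Logt t z ∈ N.U)
    (hW : P.W t z = 0) :
    Real.log ‖P.term t j z‖ = (root (N.flat γ t z)).re ∧ N.relPhase γ t root z = 1 := by
  have hT := P.term_ne_zero ht j hz
  set w := Complex.log (-P.term t j z) with hw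
  have hre : w.re = Real.log ‖P.term t j z‖ := by rw [hw, Complex.log_re, norm_neg]
  have hexp : Complex.exp w = -P.term t j z := Complex.exp_log (neg_ne_zero.2 hT)
  have him : Complex.exp (Complex.I * (w.im : ℂ)) = -phase (P.term t j z) := by
    have h1 : Complex.exp w = ‖P.term t j z‖ * Complex.exp (Complex.I * (w.im : ℂ)) := by
      conv_lhs => rw [← Complex.re_add_im w, Complex.exp_add, hre, ← Complex.ofReal_exp,
        Real.exp_log (norm_pos_iff.2 hT), mul_comm (w.im : ℂ)]
    have h2 : (‖P.term t j z‖ : ℂ) ≠ 0 := by exact_mod_cast norm_ne_zero_iff.2 hT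
    apply mul_left_cancel₀ h2
    rw [← h1, hexp, mul_neg, norm_mul_phase]
  have hact : N.actC γ w (N.flat γ t z) = z := by
    rw [actC, hre, him, N.act_flat ht hz]
  -- `z` is reached from its flat point by `w = log(-T)`, and `W = 0` says that this `w` solves the
  -- root equation.
  have hwr : w = root (N.flat γ t z) := by
    refine (hroot _ (N.flat_ne_zero ht hz)).2.2.1 w (Complex.neg_pi_lt_log_im _)
      (Complex.log_im_le_pi _) ?_
    rw [hact, hexp]
    rw [N.W_eq ht ht1 hz hU] at hW
    linear_combination -hW
  refine ⟨by rw [← hre, hwr], ?_⟩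
  rw [relPhase, ← him, ← hwr, ← Complex.exp_add]; simp

/-- The motion preserves the zero locus of `W`. -/
lemma IsRootMap.W_baseMove_eq_zero (hroot : N.IsRootMap γ t root) (hγ : dot (P.v j) γ = 1)
    (ht : 0 < t) (ht1 : t < 1) (ha : P.chi j a = 0) (s : ℝ) {z : Fin n → ℂ}
    (hz : ∀ i, z i ≠ 0) (hU : Logt t z ∈ N.U) (hU' : Logt t (N.baseMove γ t root a s z) ∈ N.U)
    (hW : P.W t z = 0) : P.W t (N.baseMove γ t root a s z) = 0 := by
  obtain ⟨h1, h2⟩ := hroot.relPhase_eq_one ht ht1 hz hU hW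
  have h3 : N.baseMove γ t root a s z =
      N.actC γ (root (N.flatMove γ t a s z)) (N.flatMove γ t a s z) := by
    rw [baseMove, h1, h2, twist_one, sub_self, mul_zero, zero_add, one_mul, actC]
  rw [h3] at hU' ⊢
  exact hroot.W_eq_zero hγ ht ht1 (flatMove_ne_zero ht s hz)
    (term_flatMove hγ ht ht1 ha s hz) hU'

lemma IsRootMap.continuousAt_relPhase (hroot : N.IsRootMap γ t root) (ht : 0 < t)
    {z : Fin n → ℂ} (hz : ∀ i, z i ≠ 0) : ContinuousAt (N.relPhase γ t root) z := by
  have h1 : ContinuousAt (fun z => root (N.flat γ t z)) z :=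
    ContinuousAt.comp (g := root) (hroot _ (N.flat_ne_zero ht hz)).2.2.2
      (N.continuousAt_flat ht hz)
  have h2 := continuousAt_phase_term (P := P) (j := j) ht hz
  have h3 : ContinuousAt (fun z => (root (N.flat γ t z)).im) z :=
    Complex.continuous_im.continuousAt.comp h1
  unfold relPhase
  exact h2.neg.mul (by fun_prop)

lemma IsRootMap.continuousAt_baseMove (hroot : N.IsRootMap γ t root) (ht : 0 < t) (s : ℝ)
    {z : Fin n → ℂ} (hz : ∀ i, z i ≠ 0) :
    ContinuousAt (fun w : ℝ × (Fin n → ℂ) => N.baseMove γ t root a w.1 w.2) (s, z) := by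
  have hflat : ContinuousAt (fun w : ℝ × (Fin n → ℂ) => N.flat γ t w.2) (s, z) :=
    ContinuousAt.comp (g := N.flat γ t) (N.continuousAt_flat ht hz) continuousAt_snd
  have hfm : ContinuousAt (fun w : ℝ × (Fin n → ℂ) => N.flatMove γ t a w.1 w.2) (s, z) :=
    ContinuousAt.comp (g := fun w : ℝ × (Fin n → ℂ) => slide t a w.1 w.2)
      (f := fun w : ℝ × (Fin n → ℂ) => (w.1, N.flat γ t w.2))
      (continuousAt_slide a s (N.flat_ne_zero ht hz)) (continuousAt_fst.prodMk hflat)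
  have h1 : ContinuousAt (fun w : ℝ × (Fin n → ℂ) => root (N.flat γ t w.2)) (s, z) :=
    ContinuousAt.comp (g := root) (hroot _ (N.flat_ne_zero ht hz)).2.2.2 hflat
  have h2 : ContinuousAt (fun w : ℝ × (Fin n → ℂ) => root (N.flatMove γ t a w.1 w.2)) (s, z) :=
    ContinuousAt.comp (g := root) (hroot _ (flatMove_ne_zero ht s hz)).2.2.2 hfm
  have h1re := Complex.continuous_re.continuousAt.comp h1
  have h2re := Complex.continuous_re.continuousAt.comp h2
  have h2im := Complex.continuous_im.continuousAt.comp h2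
  simp only [Function.comp_def] at h1re h2re h2im
  have hlog : ContinuousAt (fun w : ℝ × (Fin n → ℂ) => Real.log ‖P.term t j w.2‖) (s, z) :=
    ContinuousAt.comp (g := fun z => Real.log ‖P.term t j z‖) (continuousAt_log_term ht hz)
      continuousAt_snd
  have hrel : ContinuousAt (fun w : ℝ × (Fin n → ℂ) => N.relPhase γ t root w.2) (s, z) :=
    ContinuousAt.comp (g := N.relPhase γ t root) (hroot.continuousAt_relPhase ht hz)
      continuousAt_snd
  have htw : ContinuousAt (fun w : ℝ × (Fin n → ℂ) =>
      twist (2 * w.1) (N.relPhase γ t root w.2)) (s, z) :=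
    ContinuousAt.comp (g := fun w : ℝ × ℂ => twist w.1 w.2)
      (f := fun w : ℝ × (Fin n → ℂ) => (2 * w.1, N.relPhase γ t root w.2))
      continuous_twist.continuousAt (ContinuousAt.prodMk (by fun_prop) hrel)
  unfold baseMove
  exact continuousAt_act _ _ (by fun_prop) (htw.mul (by fun_prop))
    (baseMove_phase_ne_zero ht s hz _) hfm

end baseMove

end FacetNbhd

variable {N : FacetNbhd P j} {f : Fin (n - 1) → TropPoly n}

/-! ### The directions `ξ_k` and angular coordinates -/

lemma ivec_injective : Function.Injective (ivec (n := n)) := fun a b h => by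
  funext i; simpa [ivec] using congrFun h i

/-- An endpoint of a segment is an extreme point, and extreme points of a convex hull belong to the
generating set. The degenerate segment is included. -/
lemma TropPoly.mem_leading_of_cell_eq {f : TropPoly n} {x : Fin n → ℝ} {q q' : Fin n → ℤ}
    (h : f.cell x = segment ℝ (ivec q) (ivec q')) : q ∈ f.leading x := by
  have hext : ivec q ∈ (segment ℝ (ivec q) (ivec q')).extremePoints ℝ := by
    refine mem_extremePoints_iff_left.2 ⟨left_mem_segment _ _ _, ?_⟩
    rintro x₁ hx₁ x₂ hx₂ hq
    rw [segment_eq_image'] at hx₁ hx₂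
    obtain ⟨s₁, hs₁, rfl⟩ := hx₁
    obtain ⟨s₂, hs₂, rfl⟩ := hx₂
    obtain ⟨α, β, hα, hβ, hαβ, hsum⟩ := hq
    have h1 : (α * s₁ + β * s₂) • (ivec q' - ivec q) = 0 := by
      have h2 : α • (ivec q + s₁ • (ivec q' - ivec q)) + β • (ivec q + s₂ • (ivec q' - ivec q)) =
          (α + β) • ivec q + (α * s₁ + β * s₂) • (ivec q' - ivec q) := by module
      rw [h2, hαβ, one_smul] at hsum
      exact left_eq_add.1 hsum.symm
    rcases smul_eq_zero.1 h1 with h3 | h3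
    · have : s₁ = 0 := by nlinarith [mul_nonneg hα.le hs₁.1, mul_nonneg hβ.le hs₂.1]
      simp [this]
    · simp [h3]
  rw [← h] at hext
  obtain ⟨m, hm, hmq⟩ := extremePoints_convexHull_subset hext
  rwa [← ivec_injective hmq]

namespace EdgeEnd

variable (e : EdgeEnd N f)

/-- The affine functions of `q_k` and `q'_k` are both maximal along the edge, hence equal at both
ends of a segment of direction `v_j` and positive length. -/
lemma dot_xi (k : Fin (n - 1)) : dot (P.v j) (e.xi k) = 0 := by
  have key : ∀ s ∈ Set.Icc 0 e.len, (f k).coeff (e.q k) + pair (e.q k) (e.a + s • ivec (P.v j)) =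
      (f k).coeff (e.q' k) + pair (e.q' k) (e.a + s • ivec (P.v j)) := by
    intro s hs
    have h := (e.edge s hs).2 k
    have h1 := (TropPoly.mem_leading_of_cell_eq h).2
    rw [segment_symm] at h
    rw [h1, (TropPoly.mem_leading_of_cell_eq h).2]
  have h0 := key 0 ⟨le_rfl, e.len_pos.le⟩
  have h1 := key e.len ⟨e.len_pos.le, le_rfl⟩
  simp only [pair_add, pair_smul, pair_ivec, zero_mul, add_zero] at h0 h1
  have h2 : (dot (e.q k) (P.v j) : ℝ) = dot (e.q' k) (P.v j) := by
    apply mul_left_cancel₀ e.len_pos.ne'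
    linarith
  have h3 : dot (e.q k) (P.v j) = dot (e.q' k) (P.v j) := by exact_mod_cast h2
  rw [dot_comm, xi]
  simp only [dot] at h3 ⊢
  simp only [Pi.sub_apply, sub_mul, Finset.sum_sub_distrib, h3, sub_self]

/-- Together with `γ` the vectors `ξ_k` span `ℝⁿ`. -/
lemma exists_coord {γ : Fin n → ℤ} (hγ : dot (P.v j) γ = 1) (φ : Fin n → ℝ) :
    ∃ (α : ℝ) (η : Fin (n - 1) → ℝ), ∀ i, φ i = α * γ i + ∑ k, η k * e.xi k i := by
  let F : (Fin n → ℝ) →ₗ[ℝ] ℝ :=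
    { toFun := pair (P.v j)
      map_add' := pair_add _
      map_smul' := fun s x => by simp [pair_smul] }
  have hF : ∀ x, F x = pair (P.v j) x := fun _ => rfl
  have hFγ : F (ivec γ) = 1 := by rw [hF, pair_ivec, hγ]; simp
  have hξ : LinearIndependent ℝ fun k => ivec (e.xi k) := e.indep
  have hle : Submodule.span ℝ (Set.range fun k => ivec (e.xi k)) ≤ LinearMap.ker F := by
    rw [Submodule.span_le]
    rintro _ ⟨k, rfl⟩
    simp [LinearMap.mem_ker, hF, pair_ivec, e.dot_xi k]
  have hrange : LinearMap.range F = ⊤ := by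
    rw [LinearMap.range_eq_top]
    intro c
    exact ⟨c • ivec γ, by rw [map_smul, hFγ]; simp⟩
  have hrank := F.finrank_range_add_finrank_ker
  rw [hrange, finrank_top, Module.finrank_self, Module.finrank_fin_fun] at hrank
  -- The `n - 1` independent `ξ_k` fill the kernel of the pairing with `v_j`, and `γ` is a
  -- complement to it.
  have heq := Submodule.eq_of_le_of_finrank_eq hle
    (by rw [finrank_span_eq_card hξ, Fintype.card_fin]; omega)
  have hmem : φ - F φ • ivec γ ∈ LinearMap.ker F := by
    rw [LinearMap.mem_ker, map_sub, map_smul, hFγ]; simp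
  rw [← heq, Submodule.mem_span_range_iff_exists_fun] at hmem
  obtain ⟨η, hη⟩ := hmem
  refine ⟨F φ, η, fun i => ?_⟩
  have := congrFun hη i
  simp only [Finset.sum_apply, Pi.smul_apply, Pi.sub_apply, smul_eq_mul, ivec] at this
  linarith

/-! ### The points `zpt` -/

section zpt

variable (t : ℝ) (γ : Fin n → ℤ) (x : Fin n → ℝ)

lemma zpt_ne_zero (τ α : ℝ) (η : Fin (n - 1) → ℝ) (i : Fin n) : e.zpt t γ x τ α η i ≠ 0 :=
  Complex.exp_ne_zero _

lemma zpt_apply (τ α : ℝ) (η : Fin (n - 1) → ℝ) (i : Fin n) : e.zpt t γ x τ α η i =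
    (Real.exp (Real.log t * (x i + τ * P.v j i)) : ℝ) * (Complex.exp (Complex.I * (α : ℂ)) ^ γ i *
      ∏ k, Complex.exp (Complex.I * (η k : ℂ)) ^ e.xi k i) := by
  rw [zpt, Complex.exp_add, Complex.ofReal_exp]
  congr 1
  rw [← Complex.exp_int_mul]
  simp only [← Complex.exp_int_mul]
  rw [← Complex.exp_sum, ← Complex.exp_add]
  congr 1
  push_cast
  rw [mul_add, Finset.mul_sum]
  congr 1
  · ring
  · exact Finset.sum_congr rfl fun k _ => by ring

lemma zpt_congr (τ : ℝ) {α α' : ℝ} {η η' : Fin (n - 1) → ℝ}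
    (hα : Complex.exp (Complex.I * (α : ℂ)) = Complex.exp (Complex.I * (α' : ℂ)))
    (hη : ∀ k, Complex.exp (Complex.I * (η k : ℂ)) = Complex.exp (Complex.I * (η' k : ℂ))) :
    e.zpt t γ x τ α η = e.zpt t γ x τ α' η' := by
  funext i
  rw [zpt_apply, zpt_apply, hα]
  simp only [hη]

lemma Logt_zpt {t : ℝ} (ht : 0 < t) (ht1 : t < 1) (τ α : ℝ) (η : Fin (n - 1) → ℝ) :
    Logt t (e.zpt t γ x τ α η) = x + τ • ivec (P.v j) := by
  have hl : Real.log t ≠ 0 := (Real.log_neg ht ht1).ne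
  unfold zpt
  rw [Logt_exp]
  funext i
  have : (Complex.I * ((α * γ i + ∑ k, η k * e.xi k i : ℝ) : ℂ)).re = 0 := by
    rw [Complex.re_mul_ofReal]; simp
  rw [Complex.add_re, Complex.ofReal_re, this]
  simp only [Pi.add_apply, Pi.smul_apply, smul_eq_mul, ivec]
  field_simp
  ring

variable {γ}

lemma zpt_eq_act (hγ : dot (P.v j) γ = 1) (τ α β : ℝ) (η : Fin (n - 1) → ℝ) :
    e.zpt t γ x τ (α + β) η = act (P.v j) γ (Real.log t * τ * normSq (P.v j))
      (Complex.exp (Complex.I * (α : ℂ))) (e.zpt t γ x 0 β η) := by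
  have hn := (normSq_pos hγ).ne'
  funext i
  have h1 : Real.log t * (x i + τ * P.v j i) =
      Real.log t * (x i + 0 * P.v j i) + Real.log t * τ * normSq (P.v j) *
        (P.v j i / normSq (P.v j)) := by field_simp; ring
  have h2 : Complex.exp (Complex.I * ((α + β : ℝ) : ℂ)) =
      Complex.exp (Complex.I * (α : ℂ)) * Complex.exp (Complex.I * (β : ℂ)) := by
    rw [← Complex.exp_add]; congr 1; push_cast; ring
  rw [act, zpt_apply, zpt_apply, h1, h2, Real.exp_add, mul_zpow]
  push_cast; ring

lemma term_zpt' {t : ℝ} (ht : 0 < t) (hγ : dot (P.v j) γ = 1) (α : ℝ)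
    (η : Fin (n - 1) → ℝ) : P.term t j (e.zpt t γ x 0 α η) =
      ((t ^ P.chi j x : ℝ) : ℂ) * Complex.exp (Complex.I * (α : ℂ)) := by
  unfold zpt
  rw [Potential.term, monom_exp, Real.rpow_def_of_pos ht, Real.rpow_def_of_pos ht,
    Complex.ofReal_exp, Complex.ofReal_exp, ← Complex.exp_add, ← Complex.exp_add]
  congr 1
  have h1 : ∑ i, (P.v j i : ℝ) * (α * γ i + ∑ k, η k * e.xi k i) = α := by
    have h2 : ∀ i, (P.v j i : ℝ) * (α * γ i + ∑ k, η k * e.xi k i) =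
        α * (P.v j i * γ i) + ∑ k, η k * (P.v j i * e.xi k i) := fun i => by
      rw [mul_add, Finset.mul_sum]
      congr 1
      · ring
      · exact Finset.sum_congr rfl fun k _ => by ring
    simp only [h2]
    rw [Finset.sum_add_distrib, ← Finset.mul_sum, Finset.sum_comm]
    simp only [← Finset.mul_sum]
    have h3 : ∑ i, (P.v j i : ℝ) * γ i = 1 := by
      have := congrArg (Int.cast (R := ℝ)) hγ
      simpa [dot] using this
    have h4 : ∀ k, ∑ i, (P.v j i : ℝ) * e.xi k i = 0 := fun k => by
      have := congrArg (Int.cast (R := ℝ)) (e.dot_xi k)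
      simpa [dot] using this
    rw [h3]; simp [h4]
  have h5 : P.chi j x = P.lam j + ∑ i, (P.v j i : ℝ) * x i := rfl
  have h6 : ∑ i, (P.v j i : ℂ) * (((Real.log t * (x i + 0 * P.v j i) : ℝ) : ℂ) +
      Complex.I * ((α * γ i + ∑ k, η k * e.xi k i : ℝ) : ℂ)) =
      ((Real.log t * ∑ i, (P.v j i : ℝ) * x i : ℝ) : ℂ) +
        Complex.I * ((∑ i, (P.v j i : ℝ) * (α * γ i + ∑ k, η k * e.xi k i) : ℝ) : ℂ) := by
    rw [Complex.ofReal_mul, Complex.ofReal_sum, Complex.ofReal_sum, Finset.mul_sum, Finset.mul_sum,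
      ← Finset.sum_add_distrib]
    exact Finset.sum_congr rfl fun i _ => by push_cast; ring
  rw [h6, h1, ← add_assoc, ← Complex.ofReal_add, ← mul_add, h5]

lemma term_zpt {t : ℝ} (ht : 0 < t) (hγ : dot (P.v j) γ = 1) (hx : P.chi j x = 0) (α : ℝ)
    (η : Fin (n - 1) → ℝ) :
    P.term t j (e.zpt t γ x 0 α η) = Complex.exp (Complex.I * (α : ℂ)) := by
  simp [e.term_zpt' x ht hγ, hx]

/-- The points over `x` with `t^{λ_j} z^{v_j} = -1` are parametrised by the angles `η`. -/
lemma exists_zpt {t : ℝ} (ht : 0 < t) (ht1 : t < 1) (hγ : dot (P.v j) γ = 1)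
    (hx : P.chi j x = 0) {y : Fin n → ℂ} (hy : ∀ i, y i ≠ 0) (hL : Logt t y = x)
    (hT : P.term t j y = -1) : ∃ η : Fin (n - 1) → ℝ, (∀ k, η k ∈ Set.Ico 0 (2 * Real.pi)) ∧
      y = e.zpt t γ x 0 Real.pi η := by
  have hl : Real.log t ≠ 0 := (Real.log_neg ht ht1).ne
  -- The arguments of the coordinates are expanded in `γ` and the `ξ_k`. The condition on the `j`-th
  -- term then fixes the `γ`-angle to be `π` modulo `2π`.
  obtain ⟨α₀, η₀, h0⟩ := e.exists_coord hγ fun i => (y i).arg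
  have hy0 : y = e.zpt t γ x 0 α₀ η₀ := by
    funext i
    have h1 : Real.log t * (x i + 0 * P.v j i) = Real.log ‖y i‖ := by
      rw [← hL, Logt]; field_simp; ring
    rw [zpt, ← h0, h1, Complex.exp_add, Complex.ofReal_log (norm_nonneg _), Complex.exp_log
      (by exact_mod_cast norm_ne_zero_iff.2 (hy i)), mul_comm Complex.I]
    exact (Complex.norm_mul_exp_arg_mul_I _).symm
  choose η hη hη' using fun k => exists_angle (norm_exp_I_mul (η₀ k)) 0
  refine ⟨η, fun k => by simpa using hη k, ?_⟩
  rw [hy0]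
  refine e.zpt_congr t γ x 0 ?_ fun k => (hη' k).symm
  rw [hy0, e.term_zpt x ht hγ hx] at hT
  rw [hT, mul_comm, Complex.exp_pi_mul_I]

end zpt

end EdgeEnd

/-! ### The base point, smallness of `t`, and solutions of `W_{Σ,j} = 0` -/

/-- There are points of the facet inside `U` but outside `U'`. -/
lemma EdgeEnd.exists_facet_point (hn : 2 ≤ n) (e : EdgeEnd N f) :
    ∃ a', a' ∈ (P.facet j ∩ N.U) \ N.U' := by
  obtain ⟨x₀, hx₀U, hx₀F⟩ := N.meets_facet
  let k₀ : Fin (n - 1) := ⟨0, by omega⟩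
  -- Since `n ≥ 2` some `ξ_k` exists, and it is parallel to the facet. The ray from `x₀` in this
  -- direction leaves the bounded set `U'`; its first exit point lies in the closure of `U'`, hence
  -- in `U`.
  let d : Fin n → ℝ := ivec (e.xi k₀)
  have hd : d ≠ 0 := e.indep.ne_zero k₀
  let g : ℝ → Fin n → ℝ := fun s => x₀ + s • d
  have hg : Continuous g := by fun_prop
  let A : Set ℝ := Set.Ici 0 ∩ g ⁻¹' N.U'ᶜ
  have hAc : IsClosed A := isClosed_Ici.inter (N.isOpen_U'.isClosed_compl.preimage hg)
  have hAne : A.Nonempty := by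
    obtain ⟨C, hC⟩ := N.compact_U'.isBounded.subset_closedBall x₀
    have hdn : 0 < ‖d‖ := norm_pos_iff.2 hd
    refine ⟨(|C| + 1) / ‖d‖, by simp only [Set.mem_Ici]; positivity, fun hmem => ?_⟩
    have := hC (subset_closure hmem)
    rw [mem_closedBall_iff_norm] at this
    simp only [g, add_sub_cancel_left, norm_smul, Real.norm_eq_abs] at this
    rw [abs_of_nonneg (by positivity), div_mul_cancel₀ _ hdn.ne'] at this
    linarith [le_abs_self C]
  have hbdd : BddBelow A := ⟨0, fun s hs => hs.1⟩
  set s := sInf A with hs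
  have hsA : s ∈ A := hAc.csInf_mem hAne hbdd
  have hx₀ : x₀ ∈ N.U' := N.closure_U'' (subset_closure hx₀U)
  have hspos : 0 < s := by
    refine lt_of_le_of_ne hsA.1 fun h0 => hsA.2 ?_
    simpa [g, ← h0] using hx₀
  have hcl : g s ∈ closure N.U' := by
    have h1 : s ∈ closure (Set.Ico 0 s) := by
      rw [closure_Ico hspos.ne]; exact ⟨hspos.le, le_rfl⟩
    refine closure_mono ?_ (image_closure_subset_closure_image hg ⟨s, h1, rfl⟩)
    rintro _ ⟨s', hs', rfl⟩
    by_contra hcon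
    exact absurd (csInf_le hbdd (show s' ∈ A from ⟨hs'.1, hcon⟩)) (not_le.2 hs'.2)
  have hU := N.closure_U' hcl
  have hchi : P.chi j (g s) = 0 := by
    have h1 : P.lam j + pair (P.v j) x₀ = 0 := hx₀F.2
    simp only [Potential.chi, g, pair_add, pair_smul, d, pair_ivec, e.dot_xi]
    simpa using h1
  refine ⟨g s, ⟨⟨fun k => ?_, hchi⟩, hU⟩, hsA.2⟩
  by_cases hk : k = j
  · rw [hk, hchi]
  · exact (N.c_pos.trans ((N.c_lt k hk).trans (N.lt_chi _ hU k hk))).le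

/-- The requirements on `t`, for a point `a` of the facet and a set `K ⊆ U` which contains the
segments from its points to `a`. -/
structure FacetNbhd.IsSmall (N : FacetNbhd P j) (γ : Fin n → ℤ) (K : Set (Fin n → ℝ))
    (a : Fin n → ℝ) (t : ℝ) : Prop where
  pos : 0 < t
  le_exp : t ≤ Real.exp (-1)
  bound : N.restBound t ≤ 1 / 10
  lip : N.restLip γ t ≤ 1 / 4
  mem_U : ∀ x ∈ K, ∀ τ : ℝ, |τ| ≤ 4 * N.restBound t / normSq (P.v j) →
    x + τ • ivec (P.v j) ∈ N.U
  rho_eq : ∀ τ : ℝ, |τ| ≤ 4 * N.restBound t / normSq (P.v j) →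
    N.rho (a + τ • ivec (P.v j)) = 0

namespace FacetNbhd.IsSmall

variable {γ : Fin n → ℤ} {K : Set (Fin n → ℝ)} {a : Fin n → ℝ} {t : ℝ}

lemma lt_one (h : N.IsSmall γ K a t) : t < 1 :=
  h.le_exp.trans_lt (by simp)

lemma one_le_abs_log (h : N.IsSmall γ K a t) : 1 ≤ |Real.log t| := by
  have := (Real.log_le_iff_le_exp h.pos).2 h.le_exp
  rw [le_abs]; right; linarith

/-- From `t ≤ e⁻¹` one gets `|log t| ≥ 1`, so passing to `Log_t` does not enlarge displacements. -/
lemma abs_div_le (h : N.IsSmall γ K a t) (hγ : dot (P.v j) γ = 1) {r : ℝ}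
    (hr : |r| ≤ 4 * N.restBound t) :
    |r / Real.log t / normSq (P.v j)| ≤ 4 * N.restBound t / normSq (P.v j) := by
  have hn := normSq_pos hγ
  rw [abs_div, abs_of_pos hn, abs_div]
  gcongr
  exact (div_le_self (abs_nonneg _) h.one_le_abs_log).trans hr

variable {root : (Fin n → ℂ) → ℂ}

/-- Segments to `a` stay in `K`, and the deviation along `v_j` comes from two roots, each at most `2
· restBound`; this is the origin of the factor `4` in `IsSmall`. -/
lemma Logt_baseMove_mem (h : N.IsSmall γ K a t) (hγ : dot (P.v j) γ = 1)
    (hroot : N.IsRootMap γ t root) (hK : ∀ x ∈ K, ∀ s ∈ Set.Icc (0 : ℝ) 1,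
      (1 - s) • x + s • a ∈ K) {s : ℝ} (hs : s ∈ Set.Icc (0 : ℝ) 1) {z : Fin n → ℂ}
    (hz : ∀ i, z i ≠ 0) (hzK : Logt t z ∈ K) :
    Logt t (N.baseMove γ t root a s z) ∈ N.U := by
  rw [Logt_baseMove h.pos h.lt_one s hz]
  refine h.mem_U _ (hK _ hzK s hs) _ (h.abs_div_le hγ ?_)
  have h1 := (Complex.abs_re_le_norm _).trans (hroot _ (N.flat_ne_zero (γ := γ) h.pos hz)).1
  have h2 := (Complex.abs_re_le_norm _).trans
    (hroot _ (flatMove_ne_zero (N := N) (γ := γ) (a := a) h.pos s hz)).1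
  refine (abs_add_le _ _).trans ?_
  have h3 : |-(1 - s) * (root (N.flat γ t z)).re| ≤ |(root (N.flat γ t z)).re| := by
    rw [abs_mul, abs_neg]
    refine mul_le_of_le_one_left (abs_nonneg _) ?_
    rw [abs_of_nonneg (by linarith [hs.2])]; linarith [hs.1]
  linarith

variable (e : EdgeEnd N f)

/-- The value of `τ` at the singular fibre. -/
def _root_.HV.EdgeEnd.solTau (e : EdgeEnd N f) (γ : Fin n → ℤ) (t : ℝ)
    (root : (Fin n → ℂ) → ℂ) (a : Fin n → ℝ) (η : Fin (n - 1) → ℝ) : ℝ :=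
  (root (e.zpt t γ a 0 Real.pi η)).re / Real.log t / normSq (P.v j)

/-- The value of `α` at the singular fibre. -/
def _root_.HV.EdgeEnd.solAlpha (e : EdgeEnd N f) (γ : Fin n → ℤ) (t : ℝ)
    (root : (Fin n → ℂ) → ℂ) (a : Fin n → ℝ) (η : Fin (n - 1) → ℝ) : ℝ :=
  (root (e.zpt t γ a 0 Real.pi η)).im + Real.pi

lemma zpt_solTau (h : N.IsSmall γ K a t) (hγ : dot (P.v j) γ = 1) (β : ℝ)
    (η : Fin (n - 1) → ℝ) :
    e.zpt t γ a (e.solTau γ t root a η) (e.solAlpha γ t root a η + β) η =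
      act (P.v j) γ 0 (Complex.exp (Complex.I * (β : ℂ)))
        (N.actC γ (root (e.zpt t γ a 0 Real.pi η)) (e.zpt t γ a 0 Real.pi η)) := by
  have hl : Real.log t ≠ 0 := (Real.log_neg h.pos h.lt_one).ne
  have hn := (normSq_pos hγ).ne'
  have h1 : e.solAlpha γ t root a η + β =
      (β + (root (e.zpt t γ a 0 Real.pi η)).im) + Real.pi := by rw [EdgeEnd.solAlpha]; ring
  have h2 : Real.log t * e.solTau γ t root a η * normSq (P.v j) =
      0 + (root (e.zpt t γ a 0 Real.pi η)).re := by
    rw [EdgeEnd.solTau]; field_simp; ring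
  rw [h1, e.zpt_eq_act t a hγ, h2, actC, act_act, ← Complex.exp_add]
  congr 2
  push_cast; ring

lemma abs_solTau_le (h : N.IsSmall γ K a t) (hγ : dot (P.v j) γ = 1)
    (hroot : N.IsRootMap γ t root) (η : Fin (n - 1) → ℝ) :
    |e.solTau γ t root a η| ≤ 4 * N.restBound t / normSq (P.v j) := by
  refine h.abs_div_le hγ ?_
  have h1 := (Complex.abs_re_le_norm _).trans
    (hroot _ (e.zpt_ne_zero t γ a 0 Real.pi η)).1
  have h0 : 0 ≤ N.restBound t := Finset.sum_nonneg fun k _ => Real.rpow_nonneg h.pos.le _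
  linarith

lemma Wj_zpt_solTau (h : N.IsSmall γ K a t) (hγ : dot (P.v j) γ = 1)
    (hroot : N.IsRootMap γ t root) (β : ℝ) (η : Fin (n - 1) → ℝ) :
    N.Wj t (e.zpt t γ a (e.solTau γ t root a η) β η) =
      P.W t (e.zpt t γ a (e.solTau γ t root a η) β η) := by
  rw [Wj, e.Logt_zpt γ a h.pos h.lt_one, h.rho_eq _ (h.abs_solTau_le e hγ hroot η)]
  simp

/-- Whatever the cut-off `ρ` does along the orbit, a solution satisfies `e^w = 1 + (1 - ρ) rest`, so
`w` is small. Its point then lies so near `a` that `ρ = 0`, and uniqueness of `root` applies. -/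
lemma isSol_iff (h : N.IsSmall γ K a t) (hγ : dot (P.v j) γ = 1)
    (hroot : N.IsRootMap γ t root) (haK : a ∈ K) (ha : P.chi j a = 0)
    (η : Fin (n - 1) → ℝ) (τ α : ℝ) (hα : α ∈ Set.Ico 0 (2 * Real.pi)) :
    e.IsSol t γ a η τ α ↔ τ = e.solTau γ t root a η ∧ α = e.solAlpha γ t root a η := by
  have ht := h.pos
  have ht1 := h.lt_one
  have hl : Real.log t ≠ 0 := (Real.log_neg ht ht1).ne
  have hn := normSq_pos hγ
  set y := e.zpt t γ a 0 Real.pi η with hy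
  have hy0 : ∀ i, y i ≠ 0 := e.zpt_ne_zero t γ a 0 Real.pi η
  have hTy : P.term t j y = -1 := by
    rw [hy, e.term_zpt a ht hγ ha, mul_comm, Complex.exp_pi_mul_I]
  constructor
  · rintro ⟨hU, hW⟩
    set w : ℂ := ⟨Real.log t * τ * normSq (P.v j), α - Real.pi⟩ with hw
    have hz : e.zpt t γ a τ α η = N.actC γ w y := by
      have := e.zpt_eq_act t a hγ τ (α - Real.pi) Real.pi η
      rw [sub_add_cancel] at this
      rw [this, actC]
    have hL : Logt t (N.actC γ w y) = a + τ • ivec (P.v j) := by rw [← hz, e.Logt_zpt γ a ht ht1]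
    have hz0 : ∀ i, N.actC γ w y i ≠ 0 := N.actC_ne_zero w hy0
    have hUz : Logt t (N.actC γ w y) ∈ N.U := by rw [hL]; exact hU
    rw [hz, Wj, N.W_eq ht ht1 hz0 hUz, ← N.rest_eq ht ht1 hz0 hUz, N.term_actC_self hγ, hTy, hL] at hW
    obtain ⟨hρ0, hρ1⟩ := N.rho_mem (a + τ • ivec (P.v j))
    set ρ := N.rho (a + τ • ivec (P.v j)) with hρ
    have hexp : Complex.exp w = 1 + ((1 - ρ : ℝ) : ℂ) * N.rest t (N.actC γ w y) := by
      push_cast; linear_combination -hW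
    have hG : ‖((1 - ρ : ℝ) : ℂ) * N.rest t (N.actC γ w y)‖ ≤ N.restBound t := by
      rw [norm_mul, Complex.norm_real, Real.norm_of_nonneg (by linarith)]
      exact (mul_le_of_le_one_left (norm_nonneg _) (by linarith)).trans (N.norm_rest_le ht _)
    have hb := h.bound
    -- The value `α = 0` would give `w.im = -π`, where `e^w` is negative; but `e^w` is within `1/10`
    -- of `1`.
    have him : -Real.pi < w.im := by
      have h1 : -Real.pi ≤ w.im := by rw [hw]; linarith [hα.1]
      refine lt_of_le_of_ne h1 fun h2 => ?_
      have h3 : (Complex.exp w).re ≤ 0 := by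
        rw [Complex.exp_re, ← h2, Real.cos_neg, Real.cos_pi]
        have := Real.exp_pos w.re
        linarith
      rw [hexp] at h3
      have h4 := (Complex.abs_re_le_norm _).trans hG
      have h5 := neg_abs_le (((1 - ρ : ℝ) : ℂ) * N.rest t (N.actC γ w y)).re
      simp only [Complex.add_re, Complex.one_re] at h3
      linarith
    have him' : w.im ≤ Real.pi := by rw [hw]; linarith [hα.2]
    have hnorm : ‖w‖ ≤ 2 * N.restBound t := by
      have h1 := Complex.log_exp him him'
      rw [← h1, hexp]
      exact (norm_log_one_add_le' (hG.trans (by linarith))).trans (by linarith)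
    have hτ : τ = w.re / Real.log t / normSq (P.v j) := by
      rw [hw]; field_simp
    have hτle : |τ| ≤ 4 * N.restBound t / normSq (P.v j) := by
      rw [hτ]
      refine h.abs_div_le hγ ?_
      have := (Complex.abs_re_le_norm w).trans hnorm
      linarith [norm_nonneg w]
    have hρz : ρ = 0 := h.rho_eq τ hτle
    rw [hρz] at hexp
    have hwr : w = root y := (hroot y hy0).2.2.1 w him him' (by simpa using hexp)
    refine ⟨by rw [hτ, hwr, EdgeEnd.solTau], ?_⟩
    rw [EdgeEnd.solAlpha, ← hy, ← hwr, hw]; ring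
  · rintro ⟨rfl, rfl⟩
    have hU := h.mem_U a haK _ (h.abs_solTau_le e hγ hroot η)
    refine ⟨hU, ?_⟩
    rw [h.Wj_zpt_solTau e hγ hroot]
    have hz := h.zpt_solTau (root := root) e hγ 0 η
    rw [add_zero, Complex.ofReal_zero, mul_zero, Complex.exp_zero, act_zero_one] at hz
    have hL := e.Logt_zpt γ a ht ht1 (e.solTau γ t root a η) (e.solAlpha γ t root a η) η
    rw [hz] at hL ⊢
    exact hroot.W_eq_zero hγ ht ht1 hy0 hTy (by rw [hL]; exact hU)

lemma abs_im_root_le (h : N.IsSmall γ K a t) (hroot : N.IsRootMap γ t root) {y : Fin n → ℂ}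
    (hy : ∀ i, y i ≠ 0) : |(root y).im| ≤ 1 / 5 := by
  have h1 := (Complex.abs_im_le_norm _).trans (hroot y hy).1
  have := h.bound
  linarith

lemma solAlpha_mem (h : N.IsSmall γ K a t) (hroot : N.IsRootMap γ t root)
    (η : Fin (n - 1) → ℝ) : e.solAlpha γ t root a η ∈ Set.Ico 0 (2 * Real.pi) := by
  have h1 := abs_le.1 (h.abs_im_root_le hroot (e.zpt_ne_zero t γ a 0 Real.pi η))
  have := Real.pi_gt_three
  rw [EdgeEnd.solAlpha]
  constructor <;> linarith [h1.1, h1.2]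

lemma hasSingularFiber (h : N.IsSmall γ K a t) (hγ : dot (P.v j) γ = 1)
    (hroot : N.IsRootMap γ t root) (haK : a ∈ K) (ha : P.chi j a = 0) :
    e.HasSingularFiber t γ a := by
  intro η _
  refine ⟨(e.solTau γ t root a η, e.solAlpha γ t root a η),
    ⟨h.solAlpha_mem e hroot η, ?_⟩, ?_⟩
  · exact (h.isSol_iff e hγ hroot haK ha η _ _ (h.solAlpha_mem e hroot η)).2 ⟨rfl, rfl⟩
  · rintro ⟨τ, α⟩ ⟨hα, hsol⟩
    obtain ⟨h1, h2⟩ := (h.isSol_iff e hγ hroot haK ha η τ α hα).1 hsol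
    rw [h1, h2]

end FacetNbhd.IsSmall

/-! ### The two stages of the homotopy -/

/-- Balancing `|u|` and `|v|` with `z` fixed. -/
def balance (s : ℝ) (q : Pt n) : Pt n := (q.1, bal s q.2.1 q.2.2, bal s q.2.2 q.2.1)

/-- The balanced point over `z` whose `u` has the phase `c`. -/
def lift (P : Potential n p) (t : ℝ) (z : Fin n → ℂ) (c : ℂ) : Pt n :=
  (z, (√‖P.W t z‖ : ℂ) * c, halfv (P.W t z) * star c)

/-- Moving balanced points along `baseMove`. -/
def FacetNbhd.carry (N : FacetNbhd P j) (γ : Fin n → ℤ) (t : ℝ) (root : (Fin n → ℂ) → ℂ)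
    (a : Fin n → ℝ) (s : ℝ) (q : Pt n) : Pt n :=
  lift P t (N.baseMove γ t root a s q.1) (twist s (phase q.2.1))

lemma lift_mul {t : ℝ} {z : Fin n → ℂ} {c : ℂ} (h : ‖c‖ = 1 ∨ P.W t z = 0) :
    (lift P t z c).2.1 * (lift P t z c).2.2 = P.W t z := by
  rcases h with h | h
  · have : c * star c = 1 := by
      have := Complex.mul_conj c
      rw [Complex.normSq_eq_norm_sq, h] at this
      simpa using this
    calc _ = ((√‖P.W t z‖ : ℂ) * halfv (P.W t z)) * (c * star c) := by
          simp only [lift]; ring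
      _ = P.W t z := by rw [sqrt_mul_halfv, this, mul_one]
  · simp [lift, h]

lemma lift_of_W_eq_zero {t : ℝ} {z : Fin n → ℂ} (h : P.W t z = 0) (c c' : ℂ) :
    lift P t z c = lift P t z c' := by simp [lift, h, halfv]

lemma continuousOn_balance :
    ContinuousOn (fun w : ℝ × Pt n => balance w.1 w.2) {w | w.1 ≤ 1} := by
  refine ContinuousOn.prodMk (by fun_prop) (ContinuousOn.prodMk ?_ ?_)
  · exact continuousOn_bal.comp (f := fun w : ℝ × Pt n => (w.1, w.2.2.1, w.2.2.2))
      (by fun_prop) fun w hw => hw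
  · exact continuousOn_bal.comp (f := fun w : ℝ × Pt n => (w.1, w.2.2.2, w.2.2.1))
      (by fun_prop) fun w hw => hw

lemma balance_zero (q : Pt n) : balance 0 q = q := by
  simp [balance, bal_zero]

lemma balance_mem_Yj {t R s : ℝ} (hs : s ∈ Set.Icc (0 : ℝ) 1) {q : Pt n} (hq : q ∈ N.Yj t R) :
    balance s q ∈ N.Yj t R := by
  obtain ⟨⟨hz, hW⟩, hu, hv, hU⟩ := hq
  refine ⟨⟨hz, by simp only [balance]; rw [bal_mul, hW]⟩, ?_, ?_, hU⟩
  · have := sq_norm_bal_le (m := 2 * R) hs (by linarith : ‖q.2.1‖ ^ 2 ≤ 2 * R)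
      (by linarith : ‖q.2.2‖ ^ 2 ≤ 2 * R)
    simp only [balance]; linarith
  · have := sq_norm_bal_le (m := 2 * R) hs (by linarith : ‖q.2.2‖ ^ 2 ≤ 2 * R)
      (by linarith : ‖q.2.1‖ ^ 2 ≤ 2 * R)
    simp only [balance]; linarith

/-- Balanced points are determined by `z` and the phase of `u`. -/
lemma balance_one {t : ℝ} {q : Pt n} (hq : q ∈ P.Yt t) :
    balance 1 q = lift P t q.1 (phase q.2.1) := by
  rcases eq_or_ne q.2.1 0 with hu | hu
  · have hW : P.W t q.1 = 0 := by rw [← hq.2, hu, zero_mul]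
    simp [balance, lift, bal_one, hu, hW]
  · have h1 : phase q.2.1 * star (phase q.2.1) = 1 := by
      have := Complex.mul_conj (phase q.2.1)
      rw [Complex.normSq_eq_norm_sq, norm_phase hu] at this
      simpa using this
    have h2 : halfv (P.W t q.1) * star (phase q.2.1) = √‖P.W t q.1‖ * phase q.2.2 := by
      rw [halfv_eq]
      nth_rewrite 2 [← hq.2]
      rw [phase_mul]
      linear_combination (√‖P.W t q.1‖ : ℂ) * phase q.2.2 * h1
    simp only [balance, lift, bal_one, h2]
    rw [mul_comm q.2.2, hq.2]

lemma phase_lift {t : ℝ} {z : Fin n → ℂ} {c : ℂ} (hc : ‖c‖ = 1) (hW : P.W t z ≠ 0) :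
    phase (lift P t z c).2.1 = c := by
  have h : 0 < √‖P.W t z‖ := Real.sqrt_pos.2 (norm_pos_iff.2 hW)
  simp only [lift]
  rw [phase_mul, phase_of_pos h, phase_of_norm_one hc, one_mul]

lemma norm_W_le (P : Potential n p) (t : ℝ) (z : Fin n → ℂ) :
    ‖P.W t z‖ ≤ 1 + ∑ k, ‖P.term t k z‖ := by
  refine (norm_add_le _ _).trans ?_
  rw [norm_one]
  gcongr
  exact norm_sum_le _ _

lemma lift_mem_Yj {t : ℝ} (D : Deformation N t) {z : Fin n → ℂ} (hz : ∀ i, z i ≠ 0)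
    (hU : Logt t z ∈ N.U) {c : ℂ} (hc : ‖c‖ ≤ 1) (h : ‖c‖ = 1 ∨ P.W t z = 0) :
    lift P t z c ∈ N.Yj t D.R := by
  have hb := D.bound z hz hU
  have hW := norm_W_le P t z
  have h1 := D.R'_lt
  have h2 := D.R''_lt
  have hs := Real.sq_sqrt (norm_nonneg (P.W t z))
  have hle : ∀ r : ℝ, 0 ≤ r → r ≤ √‖P.W t z‖ → r ^ 2 / 2 ≤ D.R := by
    intro r hr hr'
    have : r ^ 2 ≤ √‖P.W t z‖ ^ 2 := by gcongr
    linarith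
  refine ⟨⟨hz, lift_mul h⟩, hle _ (norm_nonneg _) ?_, hle _ (norm_nonneg _) ?_, hU⟩
  · simp only [lift]
    rw [norm_mul, Complex.norm_real, Real.norm_of_nonneg (Real.sqrt_nonneg _)]
    exact mul_le_of_le_one_right (Real.sqrt_nonneg _) hc
  · simp only [lift]
    rw [norm_mul, norm_halfv, norm_star]
    exact mul_le_of_le_one_right (Real.sqrt_nonneg _) hc

/-- The standing assumptions on the base point `a` and the set `K`. -/
structure FacetNbhd.IsStar (N : FacetNbhd P j) (γ : Fin n → ℤ)
    (K : Set (Fin n → ℝ)) (a : Fin n → ℝ) : Prop where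
  dot_eq : dot (P.v j) γ = 1
  chi_eq : P.chi j a = 0
  mem : a ∈ K
  subset : K ⊆ N.U
  segment : ∀ x ∈ K, ∀ s ∈ Set.Icc (0 : ℝ) 1, (1 - s) • x + s • a ∈ K

namespace FacetNbhd.IsSmall

variable {γ : Fin n → ℤ} {K : Set (Fin n → ℝ)} {a : Fin n → ℝ} {t : ℝ}
  {root : (Fin n → ℂ) → ℂ}

lemma W_baseMove_eq_zero (h : N.IsSmall γ K a t) (hs : N.IsStar γ K a)
    (hroot : N.IsRootMap γ t root) {s : ℝ} (h01 : s ∈ Set.Icc (0 : ℝ) 1) {z : Fin n → ℂ}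
    (hz : ∀ i, z i ≠ 0) (hK : Logt t z ∈ K) (hW : P.W t z = 0) :
    P.W t (N.baseMove γ t root a s z) = 0 :=
  hroot.W_baseMove_eq_zero hs.dot_eq h.pos h.lt_one hs.chi_eq s hz (hs.subset hK)
    (h.Logt_baseMove_mem hs.dot_eq hroot hs.segment h01 hz hK) hW

lemma carry_mem_Yj (h : N.IsSmall γ K a t) (hs : N.IsStar γ K a)
    (hroot : N.IsRootMap γ t root) (D : Deformation N t) {s : ℝ} (h01 : s ∈ Set.Icc (0 : ℝ) 1)
    {q : Pt n} (hq : q ∈ P.Yt t) (hK : Logt t q.1 ∈ K) :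
    N.carry γ t root a s q ∈ N.Yj t D.R := by
  refine lift_mem_Yj D (baseMove_ne_zero h.pos s hq.1)
    (h.Logt_baseMove_mem hs.dot_eq hroot hs.segment h01 hq.1 hK) ?_ ?_
  · rw [norm_twist]; exact norm_phase_le _
  · rcases eq_or_ne q.2.1 0 with hu | hu
    · right
      exact h.W_baseMove_eq_zero hs hroot h01 hq.1 hK (by rw [← hq.2, hu, zero_mul])
    · left; rw [norm_twist, norm_phase hu]

/-- Where `u = 0` the phase of `u` may jump. There `W = 0` initially, hence throughout the motion,
so both fibre coordinates carry a vanishing factor in front of the phase. -/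
lemma continuousOn_carry (h : N.IsSmall γ K a t) (hs : N.IsStar γ K a)
    (hroot : N.IsRootMap γ t root) :
    ContinuousOn (fun w : ℝ × Pt n => N.carry γ t root a w.1 w.2)
      {w | w.1 ∈ Set.Icc (0 : ℝ) 1 ∧ w.2 ∈ P.Yt t ∧ Logt t w.2.1 ∈ K} := by
  rintro ⟨s, z, u, v⟩ ⟨h01, hq, hK⟩
  simp only at h01 hK
  have hb : ContinuousAt (fun w : ℝ × Pt n => N.baseMove γ t root a w.1 w.2.1) (s, z, u, v) :=
    ContinuousAt.comp (g := fun w : ℝ × (Fin n → ℂ) => N.baseMove γ t root a w.1 w.2)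
      (f := fun w : ℝ × Pt n => (w.1, w.2.1))
      (hroot.continuousAt_baseMove h.pos s hq.1) (by fun_prop)
  have hW : ContinuousAt (fun w : ℝ × Pt n => P.W t (N.baseMove γ t root a w.1 w.2.1))
      (s, z, u, v) :=
    ContinuousAt.comp (g := P.W t) (P.continuousAt_W t (baseMove_ne_zero h.pos s hq.1)) hb
  have h1 : ContinuousAt
      (fun w : ℝ × Pt n => (√‖P.W t (N.baseMove γ t root a w.1 w.2.1)‖ : ℂ)) (s, z, u, v) :=
    ContinuousAt.comp (g := fun c : ℂ => (√‖c‖ : ℂ)) (by fun_prop) hW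
  have h2 : ContinuousAt
      (fun w : ℝ × Pt n => halfv (P.W t (N.baseMove γ t root a w.1 w.2.1))) (s, z, u, v) :=
    ContinuousAt.comp (g := halfv) continuous_halfv.continuousAt hW
  refine hb.continuousWithinAt.prodMk ?_
  rcases eq_or_ne u 0 with rfl | hu
  · have hW0 : P.W t (N.baseMove γ t root a s z) = 0 := by
      refine h.W_baseMove_eq_zero hs hroot h01 hq.1 hK ?_
      have := hq.2
      simpa using this.symm
    have hle : ∀ w : ℝ × Pt n, ‖twist w.1 (phase w.2.2.1)‖ ≤ 1 := fun w => by
      rw [norm_twist]; exact norm_phase_le _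
    refine ContinuousWithinAt.prodMk ?_ ?_
    · exact continuousWithinAt_mul_of_zero h1.continuousWithinAt (by simp [hW0]) hle
    · exact continuousWithinAt_mul_of_zero h2.continuousWithinAt (by simp [hW0, halfv])
        fun w => by rw [norm_star]; exact hle w
  · have h3 : ContinuousAt (fun w : ℝ × Pt n => phase w.2.2.1) (s, z, u, v) :=
      ContinuousAt.comp (f := fun w : ℝ × Pt n => w.2.2.1) (continuousAt_phase hu) (by fun_prop)
    have h4 : ContinuousAt (fun w : ℝ × Pt n => twist w.1 (phase w.2.2.1)) (s, z, u, v) :=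
      ContinuousAt.comp (g := fun w : ℝ × ℂ => twist w.1 w.2)
        (f := fun w : ℝ × Pt n => (w.1, phase w.2.2.1))
        continuous_twist.continuousAt (continuousAt_fst.prodMk h3)
    exact ((h1.mul h4).prodMk (h2.mul h4.star)).continuousWithinAt

/-- Makes the two stages of the homotopy agree where they meet. -/
lemma carry_zero_balance_one (h : N.IsSmall γ K a t) {q : Pt n} (hq : q ∈ P.Yt t) :
    N.carry γ t root a 0 (balance 1 q) = balance 1 q := by
  have h1 : N.baseMove γ t root a 0 q.1 = q.1 := baseMove_zero h.pos hq.1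
  have h2 : (balance 1 q).1 = q.1 := rfl
  rw [carry, h2, h1, twist_zero_left, balance_one hq]
  by_cases hW : P.W t q.1 = 0
  · exact lift_of_W_eq_zero hW _ _
  · have hu : q.2.1 ≠ 0 := fun hu => hW (by rw [← hq.2, hu, zero_mul])
    rw [phase_lift (norm_phase hu) hW]

/-- `carry` sees only `z` and the phase of `u`, which balancing keeps; where the phase is lost, `W`
vanishes and the phase has no effect. -/
lemma carry_balance_one (h : N.IsSmall γ K a t) (hs : N.IsStar γ K a)
    (hroot : N.IsRootMap γ t root) {s : ℝ} (h01 : s ∈ Set.Icc (0 : ℝ) 1) {q : Pt n}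
    (hq : q ∈ P.Yt t) (hK : Logt t q.1 ∈ K) :
    N.carry γ t root a s (balance 1 q) = N.carry γ t root a s q := by
  have h2 : (balance 1 q).1 = q.1 := rfl
  rw [carry, carry, h2, balance_one hq]
  by_cases hW : P.W t q.1 = 0
  · exact lift_of_W_eq_zero (h.W_baseMove_eq_zero hs hroot h01 hq.1 hK hW) _ _
  · have hu : q.2.1 ≠ 0 := fun hu => hW (by rw [← hq.2, hu, zero_mul])
    rw [phase_lift (norm_phase hu) hW]

/-! ### The end of the homotopy -/

variable (e : EdgeEnd N f)

lemma mem_SF_iff (h : N.IsSmall γ K a t) (hs : N.IsStar γ K a) (hroot : N.IsRootMap γ t root)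
    (y : Pt n) : y ∈ e.SF t γ a ↔ ∃ η : Fin (n - 1) → ℝ, (∀ k, η k ∈ Set.Icc 0 (2 * Real.pi)) ∧
      ∃ ηa ∈ Set.Icc 0 (2 * Real.pi), ∃ θ ∈ Set.Icc 0 (2 * Real.pi),
        y = lift P t (e.zpt t γ a (e.solTau γ t root a η) (e.solAlpha γ t root a η + ηa) η)
          (Complex.exp (Complex.I * (θ : ℂ))) := by
  have hstar : ∀ θ : ℝ, star (Complex.exp (Complex.I * (θ : ℂ))) =
      Complex.exp (-(Complex.I * (θ : ℂ))) := fun θ => by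
    rw [Complex.star_def, ← Complex.exp_conj]; simp
  constructor
  · rintro ⟨η, hη, ηa, hηa, θ, hθ, τ, α, hα, hsol, h1, h2, h3⟩
    obtain ⟨rfl, rfl⟩ := (h.isSol_iff e hs.dot_eq hroot hs.mem hs.chi_eq η τ α hα).1 hsol
    refine ⟨η, hη, ηa, hηa, θ, hθ, ?_⟩
    rw [h1, h.Wj_zpt_solTau e hs.dot_eq hroot] at h2 h3
    refine Prod.ext h1 (Prod.ext h2 ?_)
    rw [h3]; simp only [lift, halfv, hstar]
  · rintro ⟨η, hη, ηa, hηa, θ, hθ, rfl⟩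
    refine ⟨η, hη, ηa, hηa, θ, hθ, e.solTau γ t root a η, e.solAlpha γ t root a η,
      h.solAlpha_mem e hroot η, ?_, rfl, ?_, ?_⟩
    · exact (h.isSol_iff e hs.dot_eq hroot hs.mem hs.chi_eq η _ _
        (h.solAlpha_mem e hroot η)).2 ⟨rfl, rfl⟩
    · simp only [lift, h.Wj_zpt_solTau e hs.dot_eq hroot]
    · simp only [lift, h.Wj_zpt_solTau e hs.dot_eq hroot, halfv, hstar]

lemma baseMove_one_eq (h : N.IsSmall γ K a t) (hs : N.IsStar γ K a) {z : Fin n → ℂ}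
    {η : Fin (n - 1) → ℝ} (hη : N.flatMove γ t a 1 z = e.zpt t γ a 0 Real.pi η) {β : ℝ}
    (hβ : Complex.exp (Complex.I * (β : ℂ)) = twist 2 (N.relPhase γ t root z)) :
    N.baseMove γ t root a 1 z =
      e.zpt t γ a (e.solTau γ t root a η) (e.solAlpha γ t root a η + β) η := by
  rw [h.zpt_solTau e hs.dot_eq, baseMove_one, hη, hβ]

lemma carry_one_mem_SF (h : N.IsSmall γ K a t) (hs : N.IsStar γ K a)
    (hroot : N.IsRootMap γ t root) {q : Pt n} (hq : q ∈ P.Yt t) (hK : Logt t q.1 ∈ K) :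
    N.carry γ t root a 1 q ∈ e.SF t γ a := by
  rw [h.mem_SF_iff e hs hroot]
  obtain ⟨η, hη, hz⟩ := e.exists_zpt a h.pos h.lt_one hs.dot_eq hs.chi_eq
    (flatMove_ne_zero (N := N) (γ := γ) (a := a) h.pos 1 hq.1)
    (Logt_flatMove_one h.pos h.lt_one hq.1)
    (term_flatMove hs.dot_eq h.pos h.lt_one hs.chi_eq 1 hq.1)
  obtain ⟨β, hβ, hβ'⟩ := exists_angle (c := twist 2 (N.relPhase γ t root q.1))
    (by rw [norm_twist, norm_relPhase h.pos hq.1]) 0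
  rw [zero_add] at hβ
  refine ⟨η, fun k => Set.Ico_subset_Icc_self (hη k), β, Set.Ico_subset_Icc_self hβ, ?_⟩
  rw [← h.baseMove_one_eq e hs hz hβ', carry]
  rcases eq_or_ne q.2.1 0 with hu | hu
  · exact ⟨0, ⟨le_rfl, Real.two_pi_pos.le⟩, lift_of_W_eq_zero
      (h.W_baseMove_eq_zero hs hroot ⟨zero_le_one, le_rfl⟩ hq.1 hK
        (by rw [← hq.2, hu, zero_mul])) _ _⟩
  · obtain ⟨θ, hθ, hθ'⟩ := exists_angle (c := twist 1 (phase q.2.1))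
      (by rw [norm_twist, norm_phase hu]) 0
    rw [zero_add] at hθ
    exact ⟨θ, Set.Ico_subset_Icc_self hθ, by rw [hθ']⟩

lemma _root_.HV.EdgeEnd.slide_zpt (ht : 0 < t) (ht1 : t < 1) (x : Fin n → ℝ) (τ α : ℝ)
    (η : Fin (n - 1) → ℝ) : slide t a 1 (e.zpt t γ x τ α η) = e.zpt t γ a 0 α η := by
  funext i
  have hL := congrFun (e.Logt_zpt γ x ht ht1 τ α η) i
  rw [slide, hL]
  simp only [EdgeEnd.zpt]
  rw [← Complex.exp_add]
  congr 1
  simp only [Pi.add_apply, Pi.smul_apply, smul_eq_mul, ivec]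
  push_cast; ring

lemma _root_.HV.EdgeEnd.phase_term_zpt (ht : 0 < t) (hγ : dot (P.v j) γ = 1)
    (x : Fin n → ℝ) (α : ℝ) (η : Fin (n - 1) → ℝ) :
    phase (P.term t j (e.zpt t γ x 0 α η)) = Complex.exp (Complex.I * (α : ℂ)) := by
  rw [e.term_zpt' x ht hγ, phase_mul, phase_of_pos (Real.rpow_pos_of_pos ht _), one_mul,
    phase_of_norm_one (norm_exp_I_mul α)]

lemma _root_.HV.EdgeEnd.flat_zpt (ht : 0 < t) (hγ : dot (P.v j) γ = 1)
    (x : Fin n → ℝ) (α : ℝ) (η : Fin (n - 1) → ℝ) :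
    N.flat γ t (e.zpt t γ x 0 α η) =
      e.zpt t γ x (-P.chi j x / normSq (P.v j)) Real.pi η := by
  have hn := (normSq_pos hγ).ne'
  have h1 := e.zpt_eq_act t x hγ (-P.chi j x / normSq (P.v j)) (Real.pi - α) α η
  rw [sub_add_cancel] at h1
  have h2 : Real.log ‖P.term t j (e.zpt t γ x 0 α η)‖ = P.chi j x * Real.log t := by
    rw [e.term_zpt' x ht hγ, norm_mul, norm_exp_I_mul, mul_one, Complex.norm_real,
      Real.norm_of_nonneg (Real.rpow_nonneg ht.le _), Real.log_rpow ht]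
  have h3 : Complex.exp (Complex.I * ((Real.pi - α : ℝ) : ℂ)) =
      (-Complex.exp (Complex.I * (α : ℂ)))⁻¹ := by
    rw [inv_neg, ← Complex.exp_neg, ← neg_one_mul, ← Complex.exp_pi_mul_I, ← Complex.exp_add]
    congr 1; push_cast; ring
  have h4 : Real.log t * (-P.chi j x / normSq (P.v j)) * normSq (P.v j) =
      -(P.chi j x * Real.log t) := by field_simp
  rw [h1, h3, h4, FacetNbhd.flat, e.phase_term_zpt ht hγ, h2]

/-- The points of `σ̃(1/2)` in terms of their angles. -/
lemma _root_.HV.EdgeEnd.zpt_mem_cyc (ht : 0 < t) (x : Fin n → ℝ) {h : ℝ}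
    (η : Fin (n - 1) → ℝ) : e.zpt t γ x 0 (2 * Real.pi * h) η ∈
      cyc {(∑ k, (ivec (e.q k) + (η k / (2 * Real.pi)) • ivec (e.xi k))) + h • ivec γ}
        (sreal t x) := by
  refine ⟨_, rfl, ?_⟩
  funext i
  rw [EdgeEnd.zpt, sreal, Real.rpow_def_of_pos ht, Complex.ofReal_exp, ← Complex.exp_add]
  have hpi := Real.pi_pos.ne'
  have h1 : (((∑ k, (ivec (e.q k) + (η k / (2 * Real.pi)) • ivec (e.xi k))) + h • ivec γ :
      Fin n → ℝ) i : ℝ) = ((∑ k, e.q k i : ℤ) : ℝ) +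
        (2 * Real.pi * h * γ i + ∑ k, η k * e.xi k i) / (2 * Real.pi) := by
    simp only [Pi.add_apply, Finset.sum_apply, Pi.smul_apply, smul_eq_mul, ivec,
      Finset.sum_add_distrib, add_div, Finset.sum_div]
    push_cast
    have : ∀ k, η k / (2 * Real.pi) * (e.xi k i : ℝ) = η k * e.xi k i / (2 * Real.pi) :=
      fun k => by ring
    simp only [this]
    field_simp
    ring
  rw [h1]
  have h2 : Complex.exp (2 * Real.pi * Complex.I * (((∑ k, e.q k i : ℤ) : ℝ) : ℂ)) = 1 := by
    rw [← Complex.exp_int_mul_two_pi_mul_I (∑ k, e.q k i)]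
    congr 1; push_cast; ring
  have h3 : 2 * Real.pi * Complex.I * ((((∑ k, e.q k i : ℤ) : ℝ) +
      (2 * Real.pi * h * γ i + ∑ k, η k * e.xi k i) / (2 * Real.pi) : ℝ) : ℂ) +
      ((Real.log t * x i : ℝ) : ℂ) = 2 * Real.pi * Complex.I * (((∑ k, e.q k i : ℤ) : ℝ) : ℂ) +
      (((Real.log t * (x i + 0 * P.v j i) : ℝ) : ℂ) +
        Complex.I * ((2 * Real.pi * h * γ i + ∑ k, η k * e.xi k i : ℝ) : ℂ)) := by
    have hpi' : (Real.pi : ℂ) ≠ 0 := by exact_mod_cast hpi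
    push_cast
    field_simp
    ring
  rw [h3, Complex.exp_add (2 * Real.pi * Complex.I * _), h2, one_mul, Complex.exp_add]

/-- The angles of `Γ_av` already cover the singular fibre at the end of the homotopy. -/
lemma exists_mem_GammaAv (h : N.IsSmall γ K a t) (hs : N.IsStar γ K a)
    (hroot : N.IsRootMap γ t root) (A : EdgeEnd.AddData n) (hA : A.γ = γ)
    (hrp : 0 < A.rp (1 / 2)) {y : Pt n} (hy : y ∈ e.SF t γ a) :
    ∃ q ∈ e.GammaAv t A, N.carry γ t root a 1 q = y := by
  have ht := h.pos
  have ht1 := h.lt_one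
  have hpi := Real.pi_gt_three
  obtain ⟨η, hη, ηa, -, θ, hθ, rfl⟩ := (h.mem_SF_iff e hs hroot y).1 hy
  set x := A.r (1 / 2) with hx
  set y₀ := e.zpt t γ x (-P.chi j x / normSq (P.v j)) Real.pi η with hy₀
  -- At the end of the motion upper half circle angles are tripled. Choosing the target angle in
  -- `[π/2, 5π/2)` puts its third `β` in `[π/6, 5π/6]`, at a distance from `0` and `π` greater than
  -- the root's angular error, which is at most `1/5`.
  obtain ⟨φ, hφ, hφ'⟩ := exists_angle (norm_exp_I_mul ηa) (Real.pi / 2)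
  have hδ := abs_le.1 (h.abs_im_root_le hroot
    (e.zpt_ne_zero t γ x (-P.chi j x / normSq (P.v j)) Real.pi η))
  rw [← hy₀] at hδ
  set δ := (root y₀).im with hδ'
  set β := φ / 3 with hβ
  have hβ0 : Real.pi / 6 ≤ β := by linarith [hφ.1]
  have hβ1 : β ≤ 5 * Real.pi / 6 := by linarith [hφ.2]
  -- The `γ`-angle whose position relative to the zero of `W` is `β`: the zero sits at angle `π +
  -- δ`.
  set η₁ := (β + Real.pi + δ) / (2 * Real.pi) with hη₁
  have h2π : 2 * Real.pi * η₁ = β + Real.pi + δ := by rw [hη₁]; field_simp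
  have hη₁0 : 0 ≤ η₁ := by rw [hη₁]; apply div_nonneg <;> linarith [hδ.1]
  have hη₁1 : η₁ ≤ 1 := by rw [hη₁, div_le_one (by linarith)]; linarith [hδ.2]
  set z := e.zpt t γ x 0 (2 * Real.pi * η₁) η with hz
  have hz0 : ∀ i, z i ≠ 0 := e.zpt_ne_zero t γ x 0 _ η
  -- The final stretching doubles upper half circle angles, so the phase `θ/2 ≤ π` is needed. `Γ_av`
  -- offers all phases up to `2πη₁`, and `2πη₁ ≥ π`.
  set c := Complex.exp (Complex.I * ((θ / 2 : ℝ) : ℂ)) with hc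
  set u : ℂ := c * (√(2 * A.rp (1 / 2)) : ℂ) with hu
  have hrp' : 0 < √(2 * A.rp (1 / 2)) := Real.sqrt_pos.2 (by linarith)
  have hphase : phase u = c := by
    rw [hu, phase_mul, phase_of_pos hrp', mul_one, phase_of_norm_one (norm_exp_I_mul _)]
  have hu0 : u ≠ 0 := mul_ne_zero (Complex.exp_ne_zero _) (by exact_mod_cast hrp'.ne')
  have hYt : ((z, u, P.W t z / u) : Pt n) ∈ P.Yt t := ⟨hz0, mul_div_cancel₀ _ hu0⟩
  refine ⟨(z, u, P.W t z / u), ⟨hYt, _, ⟨fun k => η k / (2 * Real.pi), fun k => ?_, rfl⟩,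
    η₁, ⟨hη₁0, hη₁1⟩, (θ / 2) / (2 * Real.pi * η₁), ⟨?_, ?_⟩, ?_, ?_⟩, ?_⟩
  · exact ⟨div_nonneg (hη k).1 (by linarith), (div_le_one (by linarith)).2 (hη k).2⟩
  · rw [h2π]; apply div_nonneg <;> linarith [hθ.1, hδ.1]
  · rw [h2π, div_le_one (by linarith [hδ.1])]; linarith [hθ.2, hδ.1]
  · rw [hA]; exact e.zpt_mem_cyc ht x η
  · have : θ / 2 / (2 * Real.pi * η₁) * (2 * Real.pi * η₁) = θ / 2 :=
      div_mul_cancel₀ _ (by rw [h2π]; linarith [hδ.1])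
    rw [this]
  · have hflat : N.flat γ t z = y₀ := e.flat_zpt ht hs.dot_eq x _ η
    have hmove : N.flatMove γ t a 1 z = e.zpt t γ a 0 Real.pi η := by
      rw [FacetNbhd.flatMove, hflat]; exact e.slide_zpt ht ht1 x _ _ η
    have hrel : N.relPhase γ t root z = Complex.exp (Complex.I * (β : ℂ)) := by
      rw [relPhase, hflat, ← hδ', hz, e.phase_term_zpt ht hs.dot_eq, h2π, ← neg_one_mul,
        ← Complex.exp_neg_pi_mul_I, ← Complex.exp_add, ← Complex.exp_add]
      congr 1; push_cast; ring
    have htw : Complex.exp (Complex.I * (ηa : ℂ)) = twist 2 (N.relPhase γ t root z) := by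
      rw [hrel, twist_exp 2 (by linarith) (by linarith), ← hφ']
      congr 3; rw [hβ]; ring
    have htw' : twist 1 c = Complex.exp (Complex.I * (θ : ℂ)) := by
      rw [hc, twist_exp 1 (by linarith [hθ.1]) (by linarith [hθ.2])]
      congr 3; ring
    rw [FacetNbhd.carry]
    simp only
    rw [h.baseMove_one_eq e hs hmove htw, hphase, htw']

end FacetNbhd.IsSmall

/-! ### Small `t`, and the compact set below the chains -/

open Filter Topology in
lemma FacetNbhd.tendsto_sum_rpow (N : FacetNbhd P j) (C : Fin p → ℝ) :
    Tendsto (fun t : ℝ => ∑ k ∈ Finset.univ.erase j, t ^ N.c k * C k) (𝓝[>] 0) (𝓝 0) := by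
  have : Tendsto (fun t : ℝ => ∑ k ∈ Finset.univ.erase j, t ^ N.c k * C k) (𝓝[>] 0)
      (𝓝 (∑ k ∈ Finset.univ.erase j, (0 : ℝ) * C k)) := by
    refine tendsto_finsetSum _ fun k hk => Tendsto.mul_const _ ?_
    have hc : 0 < N.c k := N.c_pos.trans (N.c_lt k (Finset.ne_of_mem_erase hk))
    have h := (Real.continuous_rpow_const hc.le).tendsto 0
    rw [Real.zero_rpow hc.ne'] at h
    exact h.mono_left nhdsWithin_le_nhds
  simpa using this

open Filter Topology in
/-- All sufficiently small `t` are good. -/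
lemma FacetNbhd.IsStar.exists_isSmall {γ : Fin n → ℤ} {K : Set (Fin n → ℝ)} {a : Fin n → ℝ}
    (hs : N.IsStar γ K a) (hK : IsCompact K) (ha : a ∈ P.facet j) (haU' : a ∉ N.U') :
    ∃ t₀ > 0, ∀ t : ℝ, 0 < t → t < t₀ → N.IsSmall γ K a t := by
  have hn := normSq_pos hs.dot_eq
  obtain ⟨δ, hδ, hKδ⟩ := hK.exists_thickening_subset_open N.isOpen_U hs.subset
  obtain ⟨ε, hε, hρ⟩ := N.rho_const
  have hG : Tendsto N.restBound (𝓝[>] 0) (𝓝 0) := by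
    have := N.tendsto_sum_rpow fun _ => 1
    simp only [mul_one] at this
    exact this
  have hL : Tendsto (N.restLip γ) (𝓝[>] 0) (𝓝 0) := N.tendsto_sum_rpow _
  have hG' : Tendsto (fun t => 4 * N.restBound t / normSq (P.v j)) (𝓝[>] 0) (𝓝 0) := by
    simpa using (hG.const_mul 4).div_const (normSq (P.v j))
  have hG'' : Tendsto (fun t => 4 * N.restBound t / normSq (P.v j) * ‖ivec (P.v j)‖)
      (𝓝[>] 0) (𝓝 0) := by
    simpa using hG'.mul_const ‖ivec (P.v j)‖
  have hev : ∀ᶠ t in 𝓝[>] (0 : ℝ), N.IsSmall γ K a t := by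
    have h0 : ∀ᶠ t in 𝓝[>] (0 : ℝ), t < Real.exp (-1) :=
      nhdsWithin_le_nhds (Iio_mem_nhds (Real.exp_pos _))
    filter_upwards [self_mem_nhdsWithin, h0, hG.eventually_lt_const (by norm_num : (0 : ℝ) < 1 / 10),
      hL.eventually_lt_const (by norm_num : (0 : ℝ) < 1 / 4), hG'.eventually_lt_const hε,
      hG''.eventually_lt_const hδ] with t ht h1 h2 h3 h4 h5
    refine ⟨ht, h1.le, h2.le, h3.le, fun x hx τ hτ => hKδ ?_, fun τ hτ => ?_⟩
    · refine Metric.mem_thickening_iff.2 ⟨x, hx, ?_⟩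
      rw [dist_eq_norm, add_sub_cancel_left, norm_smul, Real.norm_eq_abs]
      exact (mul_le_mul_of_nonneg_right hτ (norm_nonneg _)).trans_lt h5
    -- Near the facet the cut-off is constant in the direction `v_j`, and it vanishes at `a` because
    -- `a` is outside `U'`.
    · rw [hρ a ⟨hs.subset hs.mem, ha⟩ τ (hτ.trans_lt h4), N.rho_zero a haU']
  obtain ⟨t₀, ht₀, hsub⟩ := mem_nhdsGT_iff_exists_Ioo_subset.1 hev
  exact ⟨t₀, ht₀, fun t h1 h2 => hsub ⟨h1, h2⟩⟩

lemma Logt_cyc {t : ℝ} {σ : Set (Fin n → ℝ)} {s z : Fin n → ℂ} (hz : z ∈ cyc σ s) :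
    Logt t z = Logt t s := by
  obtain ⟨m, -, rfl⟩ := hz
  funext i
  have h : ‖Complex.exp (2 * Real.pi * Complex.I * (m i : ℂ))‖ = 1 := by
    rw [← norm_exp_I_mul (2 * Real.pi * m i)]
    congr 2; push_cast; ring
  simp only [Logt]
  rw [norm_mul, h, one_mul]

lemma Logt_sreal {t : ℝ} (ht : 0 < t) (ht1 : t < 1) (x : Fin n → ℝ) :
    Logt t (sreal t x) = x := by
  have hl : Real.log t ≠ 0 := (Real.log_neg ht ht1).ne
  funext i
  rw [Logt, sreal, Complex.norm_real, Real.norm_of_nonneg (Real.rpow_nonneg ht.le _),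
    Real.log_rpow ht]
  field_simp

namespace EdgeEnd

variable (e : EdgeEnd N f)

/-- The part of `U` over which `Γ_{a,total}` lies. -/
def shadow (r : ℝ → Fin n → ℝ) : Set (Fin n → ℝ) :=
  closure N.U' ∪ e.ra '' Set.Icc 0 1 ∪ r '' Set.Icc 0 1

/-- The union of the segments from the points of `shadow` to `a'`. -/
def starShadow (r : ℝ → Fin n → ℝ) (a' : Fin n → ℝ) : Set (Fin n → ℝ) :=
  (fun w : ℝ × (Fin n → ℝ) => (1 - w.1) • w.2 + w.1 • a') '' (Set.Icc 0 1 ×ˢ e.shadow r)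

variable {e} {r : ℝ → Fin n → ℝ} {a' : Fin n → ℝ}

lemma IsAddPath.isCompact_shadow (hr : e.IsAddPath r) : IsCompact (e.shadow r) := by
  refine (N.compact_U'.union (isCompact_Icc.image ?_)).union
    (isCompact_Icc.image_of_continuousOn hr.cont)
  unfold ra; fun_prop

lemma IsAddPath.shadow_subset (hr : e.IsAddPath r) : e.shadow r ⊆ N.U := by
  rintro x ((hx | ⟨τ, hτ, rfl⟩) | ⟨τ, hτ, rfl⟩)
  · exact N.closure_U' hx
  · refine e.mem_U _ ⟨mul_nonneg (by linarith [hτ.2]) e.len_pos.le, ?_⟩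
    exact mul_le_of_le_one_left e.len_pos.le (by linarith [hτ.1])
  · exact hr.mem_U τ hτ

lemma shadow_subset_starShadow : e.shadow r ⊆ e.starShadow r a' := fun x hx =>
  ⟨(0, x), ⟨⟨le_rfl, zero_le_one⟩, hx⟩, by simp⟩

lemma IsAddPath.isCompact_starShadow (hr : e.IsAddPath r) :
    IsCompact (e.starShadow r a') := by
  refine (isCompact_Icc.prod hr.isCompact_shadow).image ?_
  fun_prop

lemma IsAddPath.isStar (hr : e.IsAddPath r) {γ : Fin n → ℤ} (hγ : dot (P.v j) γ = 1)
    (ha' : a' ∈ P.facet j ∩ N.U) : N.IsStar γ (e.starShadow r a') a' where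
  dot_eq := hγ
  chi_eq := ha'.1.2
  mem := ⟨(1, r 0), ⟨⟨zero_le_one, le_rfl⟩, Or.inr ⟨0, ⟨le_rfl, zero_le_one⟩, rfl⟩⟩, by simp⟩
  subset := by
    rintro _ ⟨⟨s, x⟩, ⟨hs, hx⟩, rfl⟩
    exact N.convex_U (hr.shadow_subset hx) ha'.2 (by linarith [hs.2]) hs.1 (by ring)
  segment := by
    rintro _ ⟨⟨s, x⟩, ⟨hs, hx⟩, rfl⟩ s' hs'
    -- Two successive moves towards `a'` leave the weight `(1 - s')(1 - s)` on `x`.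
    refine ⟨(1 - (1 - s') * (1 - s), x), ⟨⟨?_, ?_⟩, hx⟩, ?_⟩
    · have : (1 - s') * (1 - s) ≤ 1 :=
        mul_le_one₀ (by linarith [hs'.1]) (by linarith [hs.2]) (by linarith [hs.1])
      simp only; linarith
    · have : 0 ≤ (1 - s') * (1 - s) := mul_nonneg (by linarith [hs'.2]) (by linarith [hs.2])
      simp only; linarith
    · simp only; module

lemma GammaTotal_subset_Yj {t : ℝ} (D : Deformation N t) (s : ℝ → Fin n → ℂ) {A : AddData n}
    (h : e.GammaAdd t A ⊆ N.Yj t D.R) : e.GammaTotal D s A ⊆ N.Yj t D.R :=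
  Set.union_subset (fun _ hq => hq.1) h

/-- A point of `Γ_a` moved by `Φ_j` lies over `U'`; any other point of `Γ_a` is fixed and lies over
the path `r_a`. The pieces of `Γ_add` lie over `r_add`. -/
lemma Logt_mem_shadow {t : ℝ} (ht : 0 < t) (ht1 : t < 1) (D : Deformation N t)
    {s : ℝ → Fin n → ℂ} (hs : e.IsLift t s) {A : AddData n} {q : Pt n}
    (hq : q ∈ e.GammaTotal D s A) : Logt t q.1 ∈ e.shadow A.r := by
  have htilde : ∀ τ ∈ Set.Icc (0 : ℝ) 1, ∀ σ : Set (Fin n → ℝ),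
      q.1 ∈ cyc σ (sreal t (A.r τ)) → Logt t q.1 ∈ e.shadow A.r := by
    intro τ hτ σ h
    rw [Logt_cyc h, Logt_sreal ht ht1]
    exact Or.inr ⟨τ, hτ, rfl⟩
  have hhalf : (1 / 2 : ℝ) ∈ Set.Icc (0 : ℝ) 1 := by constructor <;> norm_num
  rcases hq with hq | hq
  · obtain ⟨hY, y, -, hy, -, τ, hτ, hmem⟩ := hq
    by_cases hb : inBox t D.R' N.U' q
    · exact Or.inl (Or.inl (subset_closure hb.2.2))
    · rw [← hy, D.eq_id q hY hb] at hmem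
      rw [Logt_cyc hmem, hs.log_eq τ hτ]
      exact Or.inl (Or.inr ⟨τ, hτ, rfl⟩)
  · rcases hq with (((((h | h) | h) | h) | h) | h) | h
    · obtain ⟨-, τ, hτ, h, -⟩ := h
      exact htilde τ ⟨hτ.1, by linarith [hτ.2]⟩ _ h
    · obtain ⟨-, m, -, η, -, κ, -, h, -⟩ := h
      exact htilde _ hhalf _ h
    · obtain ⟨-, τ, hτ, h, -⟩ := h
      exact htilde τ ⟨by linarith [hτ.1], hτ.2⟩ _ h
    · obtain ⟨-, τ, hτ, h, -⟩ := h
      exact htilde τ hτ _ h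
    · exact htilde 0 ⟨le_rfl, zero_le_one⟩ _ h.2.1
    · exact htilde 1 ⟨zero_le_one, le_rfl⟩ _ h.2.1
    · exact htilde _ hhalf _ h.2.1

end EdgeEnd

/-! ### Assembling the homotopy -/

/-- The homotopy from the identity, through balanced points, into the singular fibre. -/
lemma FacetNbhd.IsSmall.exists_homotopy {γ : Fin n → ℤ} {K : Set (Fin n → ℝ)} {a : Fin n → ℝ}
    {t : ℝ} {root : (Fin n → ℂ) → ℂ} (h : N.IsSmall γ K a t) (hs : N.IsStar γ K a)
    (hroot : N.IsRootMap γ t root) (D : Deformation N t) {S : Set (Pt n)}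
    (hS : S ⊆ N.Yj t D.R) (hSK : ∀ q ∈ S, Logt t q.1 ∈ K) :
    ∃ H : ↥S × unitInterval → ↥(N.Yj t D.R), Continuous H ∧
      (∀ x : ↥S, (H (x, 0) : Pt n) = x) ∧
      ∀ x : ↥S, (H (x, 1) : Pt n) = N.carry γ t root a 1 x := by
  -- The `min` and `max` keep both parameters in `[0,1]` for every time, so each branch is
  -- continuous on the whole product and the two can be glued at `1/2`.
  let G : ↥S × unitInterval → Pt n := fun w =>
    if (w.2 : ℝ) ≤ 1 / 2 then balance (min (2 * (w.2 : ℝ)) 1) w.1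
    else N.carry γ t root a (max (2 * (w.2 : ℝ) - 1) 0) (balance 1 w.1)
  have hmin : ∀ w : unitInterval, min (2 * (w : ℝ)) 1 ∈ Set.Icc (0 : ℝ) 1 := fun w =>
    ⟨le_min (by linarith [w.2.1]) zero_le_one, min_le_right _ _⟩
  have hmax : ∀ w : unitInterval, max (2 * (w : ℝ) - 1) 0 ∈ Set.Icc (0 : ℝ) 1 := fun w =>
    ⟨le_max_right _ _, max_le (by linarith [w.2.2]) zero_le_one⟩
  have hbal : ∀ x : ↥S, balance 1 (x : Pt n) ∈ N.Yj t D.R := fun x =>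
    balance_mem_Yj ⟨zero_le_one, le_rfl⟩ (hS x.2)
  have hG1 : Continuous fun w : ↥S × unitInterval => balance (min (2 * (w.2 : ℝ)) 1) (w.1 : Pt n) :=
    continuousOn_balance.comp_continuous
      (f := fun w : ↥S × unitInterval => (min (2 * (w.2 : ℝ)) 1, (w.1 : Pt n)))
      (by fun_prop) fun w => (hmin w.2).2
  have hG0 : Continuous fun w : ↥S × unitInterval => balance 1 (w.1 : Pt n) :=
    continuousOn_balance.comp_continuous
      (f := fun w : ↥S × unitInterval => ((1 : ℝ), (w.1 : Pt n)))
      (by fun_prop) fun w => le_refl (1 : ℝ)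
  have hG2 : Continuous fun w : ↥S × unitInterval =>
      N.carry γ t root a (max (2 * (w.2 : ℝ) - 1) 0) (balance 1 (w.1 : Pt n)) :=
    (h.continuousOn_carry hs hroot).comp_continuous
      (f := fun w : ↥S × unitInterval => (max (2 * (w.2 : ℝ) - 1) 0, balance 1 (w.1 : Pt n)))
      (Continuous.prodMk (by fun_prop) hG0)
      fun w => ⟨hmax w.2, (hbal w.1).1, hSK w.1.1 w.1.2⟩
  have hG : Continuous G := by
    refine Continuous.if_le hG1 hG2 (by fun_prop) continuous_const fun w hw => ?_
    rw [hw]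
    norm_num
    exact (h.carry_zero_balance_one (hS w.1.2).1).symm
  have hmem : ∀ w, G w ∈ N.Yj t D.R := by
    intro w
    by_cases hw : (w.2 : ℝ) ≤ 1 / 2
    · simp only [G, if_pos hw]
      exact balance_mem_Yj (hmin w.2) (hS w.1.2)
    · simp only [G, if_neg hw]
      exact h.carry_mem_Yj hs hroot D (hmax w.2) (hbal w.1).1 (hSK w.1.1 w.1.2)
  refine ⟨fun w => ⟨G w, hmem w⟩, hG.subtype_mk _, fun x => ?_, fun x => ?_⟩
  · simp [G, balance_zero]
  · have h1 : ¬ (((1 : unitInterval) : ℝ) ≤ 1 / 2) := by norm_num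
    have h2 : max (2 * ((1 : unitInterval) : ℝ) - 1) 0 = 1 := by norm_num
    simp only [G, if_neg h1, h2]
    exact h.carry_balance_one hs hroot ⟨zero_le_one, le_rfl⟩ (hS x.2).1 (hSK _ x.2)

end HV

end

theorem mainTheorem4 {n p : ℕ} (hn : 2 ≤ n) (P : HV.Potential n p) (j : Fin p)
    (N : HV.FacetNbhd P j) (f : Fin (n - 1) → HV.TropPoly n) (e : HV.EdgeEnd N f)
    (γ : Fin n → ℤ) (hγ : ∑ i, γ i * P.v j i = 1)
    (radd : ℝ → Fin n → ℝ) (hradd : e.IsAddPath radd) :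
    ∃ t₀ > 0, ∀ t : ℝ, 0 < t → t < t₀ →
      ∀ (D : HV.Deformation N t) (s : ℝ → Fin n → ℂ), e.IsLift t s →
      ∀ A : HV.EdgeEnd.AddData n, A.γ = γ → A.r = radd → HV.EdgeEnd.IsAdmissible N t A →
      e.GammaAdd t A ⊆ N.Yj t D.R →
      ∃ a' ∈ (P.facet j ∩ N.U) \ N.U', e.HasSingularFiber t γ a' ∧
        ∃ H : ↥(e.GammaTotal D s A) × unitInterval → ↥(N.Yj t D.R), Continuous H ∧
          (∀ x : ↥(e.GammaTotal D s A), (H (x, 0) : HV.Pt n) = x) ∧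
          Set.range (fun x : ↥(e.GammaTotal D s A) => (H (x, 1) : HV.Pt n)) =
            e.SF t γ a' := by
  have hγ' : HV.dot (P.v j) γ = 1 := by rw [HV.dot_comm]; exact hγ
  obtain ⟨a', ha'⟩ := e.exists_facet_point hn
  have hstar := hradd.isStar hγ' ha'.1
  obtain ⟨t₀, ht₀, hsmall⟩ :=
    hstar.exists_isSmall hradd.isCompact_starShadow ha'.1.1 ha'.2
  refine ⟨t₀, ht₀, fun t ht htt₀ D s hs A hAγ hAr hA hAdd => ⟨a', ha', ?_⟩⟩
  have h := hsmall t ht htt₀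
  obtain ⟨root, hroot⟩ := N.exists_root ht h.bound h.lip
  have hK : ∀ q ∈ e.GammaTotal D s A, HV.Logt t q.1 ∈ e.starShadow radd a' := fun q hq => by
    refine HV.EdgeEnd.shadow_subset_starShadow ?_
    rw [← hAr]
    exact HV.EdgeEnd.Logt_mem_shadow ht h.lt_one D hs hq
  have hY := HV.EdgeEnd.GammaTotal_subset_Yj D s hAdd
  obtain ⟨H, hH, hH0, hH1⟩ := h.exists_homotopy hstar hroot D hY hK
  refine ⟨h.hasSingularFiber e hγ' hroot hstar.mem hstar.chi_eq, H, hH, hH0, ?_⟩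
  refine Set.Subset.antisymm ?_ fun y hy => ?_
  · rintro _ ⟨x, rfl⟩
    simp only [hH1]
    exact h.carry_one_mem_SF e hstar hroot (hY x.2).1 (hK _ x.2)
  -- One of the seven pieces already maps onto the singular fiber.
  · obtain ⟨q, hq, rfl⟩ := h.exists_mem_GammaAv e hstar hroot A hAγ
      (hA.rp_pos _ (by constructor <;> norm_num)) hy
    have hqT : q ∈ e.GammaTotal D s A :=
      Or.inr (Or.inl (Or.inl (Or.inl (Or.inl (Or.inl (Or.inr hq))))))
    exact ⟨⟨q, hqT⟩, hH1 ⟨q, hqT⟩⟩
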